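/- Let $X$ be a real separable Banach space, let $Q:X^*\to X$ be linear, bounded, symmetric and nonnegative, and let $A$ be the generator of a strongly continuous contraction semigroup $(e^{tA})_{t\ge0}$ on $X$. Put $Q_tx^*=\int_0^te^{sA}Qe^{sA^*}x^*\,ds$ and assume that, for every $t>0$, $Q_t$ is the covariance operator of a centred Gaussian measure on $X$, and that for every $x^*\in X^*$ the weak limit $Q_\infty x^*=\lim_{t\to\infty}Q_tx^*$ exists, where $Q_\infty$ is the covariance operator of a centred nondegenerate Gaussian measure $\mu_\infty$ on $X$ (nondegenerate: $\langle Q_\infty x^*,x^*\rangle>0$ for all $x^*\ne0$). Let $H\subset X$ be the reproducing kernel Hilbert space of $Q$, i.e. the completion of $QX^*$ for the inner product $[Qx^*,Qy^*]_H=\langle Qx^*,y^*\rangle$, and let $i^*x^*$ be the element $Qx^*$ of $H$. Assume that there is $c>0$ such that $Q_\infty A^*x^*\in H$ and $|Q_\infty A^*x^*|_H\le c\,|i^*x^*|_H$ for all $x^*\in D(A^*)$, and let $B\in\mathcal L(H)$ be the operator with $Bi^*x^*=Q_\infty A^*x^*$ for all $x^*\in D(A^*)$. Let $\mathscr{FC}_b^1(X)$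 be the set of functions $f(x)=\varphi(\langle x,x_1^*\rangle,\dots,\langle x,x_n^*\rangle)$ with $n\in\mathbb N$, $\varphi\in C_b^1(\mathbb R^n)$, $x_j^*\in X^*$, and put $D_Hf=i^*Df$. For a measure $\gamma$ on $X$, let $W^{1,p}_H(X,\gamma)$ be the domain of the closure (still denoted by $D_H$) of $D_H:\mathscr{FC}_b^1(X)\to L^p(X,\gamma;H)$ in $L^p(X,\gamma)$, with norm $\|f\|_{L^p}+\|D_Hf\|_{L^p}$. Let $U:X\to(-\infty,+\infty]$ be proper, lower semicontinuous and convex, with $U\in W^{1,p}_H(X,\mu_\infty)$ for all $p\in[1,\infty)$, and let $\nu_\infty=e^{-U}\mu_\infty$. Let $L_2$ be the operator on $L^2(X,\nu_\infty)$ such that $u\in D(L_2)$ and $L_2u=g$ if and only if $u\in W^{1,2}_H(X,\nu_\infty)$, $g\in L^2(X,\nu_\infty)$ and $-\int_X[BD_Hu,D_Hv]_H\,d\nu_\infty=-\int_Xgv\,d\nu_\infty$ for all $v\in\mathscr{FC}_b^1(X)$. Then $L_2$ generates a strongly continuous contraction semigroup $(T_2(t))_{t\ge0}$ on $L^2(X,\nu_\infty)$,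 and for every $p\in(1,\infty)$ there is exactly one strongly continuous semigroup $(T_p(t))_{t\ge0}$ of positive contractions on $L^p(X,\nu_\infty)$ with $T_p(t)f=T_2(t)f$ for all $t\ge0$ and $f\in L^p(X,\nu_\infty)\cap L^2(X,\nu_\infty)$. Let $L_p$ be the generator of $(T_p(t))_{t\ge0}$. For all $1<p<q<\infty$ we have $D(L_q)\subset D(L_p)$ with continuous embedding (for the graph norms $\|u\|+\|L_pu\|$), and $L_qu=L_pu$ for every $u\in D(L_q)$. In particular, for every $p\in[2,\infty)$ we have $D(L_p)\subset W^{1,2}_H(X,\nu_\infty)$ with continuous embedding. -/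

import Mathlib

open MeasureTheory ProbabilityTheory Filter Topology
open scoped ENNReal NNReal

namespace WeightedOU

/-! ### Strongly continuous semigroups -/

/-- A strongly continuous semigroup of bounded linear operators on a real normed space. -/
structure C0Semigroup (E : Type*) [NormedAddCommGroup E] [NormedSpace ℝ E] where
  toFun : ℝ≥0 → E →L[ℝ] E
  map_zero : toFun 0 = ContinuousLinearMap.id ℝ E
  map_add : ∀ s t : ℝ≥0, toFun (s + t) = (toFun s).comp (toFun t)
  continuous_orbit : ∀ x : E, Continuous fun t : ℝ≥0 => toFun t x

/-- All the operators of the semigroup are contractions. -/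
def C0Semigroup.IsContraction {E : Type*} [NormedAddCommGroup E] [NormedSpace ℝ E]
    (S : C0Semigroup E) : Prop :=
  ∀ t : ℝ≥0, ‖S.toFun t‖ ≤ 1

/-- The graph of the infinitesimal generator: `(x, y)` belongs to it if and only if
`(S(t) x - x) / t → y` in norm as `t → 0+`. -/
def C0Semigroup.generator {E : Type*} [NormedAddCommGroup E] [NormedSpace ℝ E]
    (S : C0Semigroup E) : Set (E × E) :=
  {z | Tendsto (fun t : ℝ≥0 => (t : ℝ)⁻¹ • (S.toFun t z.1 - z.1)) (𝓝[>] 0) (𝓝 z.2)}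

/-- The graph of the adjoint `A^*` of the generator `A` of `S`: the functional `x'` is in `D(A^*)`
and `A^* x' = y'` if and only if `⟨A x, x'⟩ = ⟨x, y'⟩` for all `x ∈ D(A)`. -/
def C0Semigroup.adjointGenerator {E : Type*} [NormedAddCommGroup E] [NormedSpace ℝ E]
    (S : C0Semigroup E) : Set (StrongDual ℝ E × StrongDual ℝ E) :=
  {z | ∀ w ∈ S.generator, z.1 w.2 = z.2 w.1}

/-! ### Nonnegative symmetric operators and their reproducing kernel Hilbert spaces -/

/-- A bounded, symmetric and nonnegative linear operator from the dual of `X` to `X`. -/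
structure PosSymOp (X : Type*) [NormedAddCommGroup X] [NormedSpace ℝ X] where
  toCLM : StrongDual ℝ X →L[ℝ] X
  symm : ∀ x' y' : StrongDual ℝ X, y' (toCLM x') = x' (toCLM y')
  nonneg : ∀ x' : StrongDual ℝ X, 0 ≤ x' (toCLM x')

section RKHS

variable {X : Type*} [NormedAddCommGroup X] [NormedSpace ℝ X]

/-- The dual of `X`, to be endowed with the semi-inner product `(x', y') ↦ ⟨F x', y'⟩`. -/
def PreRKHS (_F : PosSymOp X) : Type _ := StrongDual ℝ X

noncomputable instance (F : PosSymOp X) : AddCommGroup (PreRKHS F) :=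
  inferInstanceAs (AddCommGroup (StrongDual ℝ X))

noncomputable instance (F : PosSymOp X) : Module ℝ (PreRKHS F) :=
  inferInstanceAs (Module ℝ (StrongDual ℝ X))

/-- The identity map from the dual of `X` to `PreRKHS F`. -/
noncomputable def toPreRKHS (F : PosSymOp X) : StrongDual ℝ X →ₗ[ℝ] PreRKHS F :=
  LinearMap.id (R := ℝ) (M := StrongDual ℝ X)

/-- The identity map from `PreRKHS F` to the dual of `X`. -/
noncomputable def ofPreRKHS (F : PosSymOp X) : PreRKHS F →ₗ[ℝ] StrongDual ℝ X :=
  LinearMap.id (R := ℝ) (M := StrongDual ℝ X)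

noncomputable abbrev preRKHSCore (F : PosSymOp X) : PreInnerProductSpace.Core ℝ (PreRKHS F) where
  inner x y := ofPreRKHS F y (F.toCLM (ofPreRKHS F x))
  conj_inner_symm x y := by
    simpa using F.symm (ofPreRKHS F y) (ofPreRKHS F x)
  re_inner_nonneg x := by
    simpa using F.nonneg (ofPreRKHS F x)
  add_left x y z := by simp
  smul_left x y r := by simp

noncomputable instance (F : PosSymOp X) : SeminormedAddCommGroup (PreRKHS F) :=
  @InnerProductSpace.Core.toSeminormedAddCommGroup ℝ (PreRKHS F) _ _ _ (preRKHSCore F)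

noncomputable instance (F : PosSymOp X) : InnerProductSpace ℝ (PreRKHS F) :=
  InnerProductSpace.ofCore (preRKHSCore F)

/-- The reproducing kernel Hilbert space of `F`: the completion of `F X^*` with respect to the
inner product `[F x', F y'] = ⟨F x', y'⟩`. (Functionals with `F x' = 0` have seminorm zero, so
that they are identified with `0` in the completion.) -/
abbrev RKHS (F : PosSymOp X) : Type _ := UniformSpace.Completion (PreRKHS F)

/-- The map `i^* : X^* → H`, which sends `x'` to the element `F x'` of `H`. -/
noncomputable def RKHS.iStar (F : PosSymOp X) : StrongDual ℝ X →ₗ[ℝ] RKHS F :=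
  (UniformSpace.Completion.toComplL (𝕜 := ℝ) (E := PreRKHS F)).toLinearMap ∘ₗ toPreRKHS F

theorem RKHS.inner_iStar (F : PosSymOp X) (x' y' : StrongDual ℝ X) :
    inner ℝ (RKHS.iStar F x') (RKHS.iStar F y') = y' (F.toCLM x') :=
  UniformSpace.Completion.inner_coe (𝕜 := ℝ) (toPreRKHS F x') (toPreRKHS F y')

theorem RKHS.denseRange_iStar (F : PosSymOp X) : DenseRange (RKHS.iStar F) := by
  have h : DenseRange ((↑) : PreRKHS F → UniformSpace.Completion (PreRKHS F)) :=
    UniformSpace.Completion.denseRange_coe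
  intro z
  refine closure_mono ?_ (h z)
  rintro _ ⟨x, rfl⟩
  exact ⟨ofPreRKHS F x, rfl⟩

/-- The continuous embedding `i : H → X`, the extension by density of `i^* x' ↦ F x'`. -/
noncomputable def RKHS.embed [CompleteSpace X] (F : PosSymOp X) : RKHS F →L[ℝ] X :=
  F.toCLM.toLinearMap.extendOfNorm (RKHS.iStar F)

theorem RKHS.norm_le (F : PosSymOp X) (x' : StrongDual ℝ X) :
    ‖F.toCLM x'‖ ≤ Real.sqrt ‖F.toCLM‖ * ‖RKHS.iStar F x'‖ := by
  obtain ⟨y', hy, hyx⟩ := exists_dual_vector'' ℝ (F.toCLM x')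
  have h1 : ‖F.toCLM x'‖ = inner ℝ (RKHS.iStar F x') (RKHS.iStar F y') := by
    rw [RKHS.inner_iStar, hyx]; rfl
  have h2 : ‖RKHS.iStar F y'‖ ≤ Real.sqrt ‖F.toCLM‖ := by
    apply Real.le_sqrt_of_sq_le
    rw [← real_inner_self_eq_norm_sq, RKHS.inner_iStar]
    calc y' (F.toCLM y') ≤ ‖y' (F.toCLM y')‖ := le_abs_self _
      _ ≤ ‖y'‖ * (‖F.toCLM‖ * ‖y'‖) :=
          (y'.le_opNorm _).trans (by gcongr; exact F.toCLM.le_opNorm _)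
      _ ≤ 1 * (‖F.toCLM‖ * 1) := by gcongr
      _ = ‖F.toCLM‖ := by ring
  calc ‖F.toCLM x'‖ = inner ℝ (RKHS.iStar F x') (RKHS.iStar F y') := h1
    _ ≤ ‖RKHS.iStar F x'‖ * ‖RKHS.iStar F y'‖ := real_inner_le_norm _ _
    _ ≤ ‖RKHS.iStar F x'‖ * Real.sqrt ‖F.toCLM‖ := by gcongr
    _ = _ := mul_comm _ _

/-- `F = i ∘ i^*`. -/
theorem RKHS.embed_iStar [CompleteSpace X] (F : PosSymOp X) (x' : StrongDual ℝ X) :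
    RKHS.embed F (RKHS.iStar F x') = F.toCLM x' :=
  LinearMap.extendOfNorm_eq (f := F.toCLM.toLinearMap) (RKHS.denseRange_iStar F)
    ⟨_, RKHS.norm_le F⟩ x'

/-- `[h, i^* x'] = ⟨i h, x'⟩`. -/
theorem RKHS.inner_iStar_right [CompleteSpace X] (F : PosSymOp X) (h : RKHS F)
    (x' : StrongDual ℝ X) : inner ℝ h (RKHS.iStar F x') = x' (RKHS.embed F h) := by
  refine (RKHS.denseRange_iStar F).induction_on
    (p := fun h => inner ℝ h (RKHS.iStar F x') = x' (RKHS.embed F h)) h ?_ ?_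
  · exact isClosed_eq (by fun_prop) (by fun_prop)
  · intro y'
    rw [RKHS.inner_iStar, RKHS.embed_iStar]

/-- The embedding of `H` in `X` is injective, so that `H` is a subspace of `X`. -/
theorem RKHS.embed_injective [CompleteSpace X] (F : PosSymOp X) :
    Function.Injective (RKHS.embed F) := by
  rw [injective_iff_map_eq_zero]
  intro h hh
  have h0 : (fun k : RKHS F => inner ℝ h k) = fun _ => 0 := by
    refine (RKHS.denseRange_iStar F).equalizer (by fun_prop) (by fun_prop) ?_
    funext x'
    simp [RKHS.inner_iStar_right, hh]
  exact inner_self_eq_zero.mp (congrFun h0 h)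

end RKHS

section Setting

variable {X : Type*} [NormedAddCommGroup X] [NormedSpace ℝ X]

/-- `Q_t x' = ∫₀ᵗ e^{sA} Q e^{sA^*} x' ds`, where `e^{tA} = S(t)` and `e^{sA^*} x' = x' ∘ e^{sA}`. -/
noncomputable def covAt (Q : PosSymOp X) (S : C0Semigroup X) (t : ℝ) (x' : StrongDual ℝ X) : X :=
  ∫ s in (0 : ℝ)..t, S.toFun s.toNNReal (Q.toCLM (x'.comp (S.toFun s.toNNReal)))

/-- `γ` is a centred Gaussian measure on `X` with covariance operator `R : X^* → X`. -/
def IsCentredGaussian [MeasurableSpace X] (γ : Measure X) (R : StrongDual ℝ X → X) : Prop :=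
  IsGaussian γ ∧ (∀ x' : StrongDual ℝ X, ∫ x, x' x ∂γ = 0) ∧
    ∀ x' y' : StrongDual ℝ X, ∫ x, x' x * y' x ∂γ = y' (R x')

/-- The bounded continuous functions on `ℝⁿ` with bounded and continuous first derivatives. -/
def IsCb1 {n : ℕ} (φ : (Fin n → ℝ) → ℝ) : Prop :=
  ContDiff ℝ 1 φ ∧ (∃ C : ℝ, ∀ ξ, |φ ξ| ≤ C) ∧ ∃ C : ℝ, ∀ ξ, ‖fderiv ℝ φ ξ‖ ≤ C

/-- The cylindrical functions `x ↦ φ(⟨x, x'₁⟩, …, ⟨x, x'ₙ⟩)` with `φ` of class `C_b^1` and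
`x'₁, …, x'ₙ` in the dual of `X`. -/
def cylindrical (X : Type*) [NormedAddCommGroup X] [NormedSpace ℝ X] : Set (X → ℝ) :=
  {f | ∃ (n : ℕ) (φ : (Fin n → ℝ) → ℝ) (x' : Fin n → StrongDual ℝ X),
    IsCb1 φ ∧ f = fun x => φ fun j => x' j x}

/-- `D_H f = i^* D f` for a cylindrical function `f`, where `H` is the reproducing kernel Hilbert
space of `Q`. -/
noncomputable def gradCyl (Q : PosSymOp X) (f : X → ℝ) (x : X) : RKHS Q :=
  RKHS.iStar Q (fderiv ℝ f x)

/-- The graph of the closure in `L^p(X, γ)` of the operator `D_H`, defined on the cylindrical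
functions with values in `L^p(X, γ; H)`. The first projection of this set is the Sobolev space
`W^{1,p}_H(X, γ)`, and `(u, F)` belongs to it if and only if `u ∈ W^{1,p}_H(X, γ)` and
`F = D_H u`. -/
def sobolevGraph [MeasurableSpace X] (Q : PosSymOp X) (γ : Measure X) (p : ℝ≥0∞)
    [Fact (1 ≤ p)] : Set (Lp ℝ p γ × Lp (RKHS Q) p γ) :=
  closure {z | ∃ f ∈ cylindrical X, z.1 =ᵐ[γ] f ∧ z.2 =ᵐ[γ] gradCyl Q f}

/-- The extended-real-valued function `U` is proper, lower semicontinuous and convex, and it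
belongs to `W^{1,p}_H(X, μ)` for all `p ∈ [1, ∞)`. -/
structure IsAdmissibleWeight [MeasurableSpace X] (Q : PosSymOp X) (μ : Measure X)
    (U : X → EReal) : Prop where
  ne_bot : ∀ x, U x ≠ ⊥
  exists_ne_top : ∃ x, U x ≠ ⊤
  lsc : LowerSemicontinuous U
  convex : Convex ℝ {z : X × ℝ | U z.1 ≤ (z.2 : EReal)}
  sobolev : ∀ (p : ℝ≥0∞) [Fact (1 ≤ p)], p ≠ ∞ →
    ∃ z ∈ sobolevGraph Q μ p, (fun x => ((z.1 x : ℝ) : EReal)) =ᵐ[μ] U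

/-- The weighted measure `ν = e^{-U} μ`. -/
noncomputable def weighted [MeasurableSpace X] (μ : Measure X) (U : X → EReal) : Measure X :=
  μ.withDensity fun x => EReal.exp (-U x)

/-- `B` is the bounded operator on `H` such that `B i^* x' = i_∞^* A^* x'` for all `x' ∈ D(A^*)`,
an identity between elements of `X` whose right-hand side is `Q_∞ A^* x'`. -/
def IsDriftOperator [CompleteSpace X] (Q : PosSymOp X) (S : C0Semigroup X)
    (Qinf : StrongDual ℝ X → X) (B : RKHS Q →L[ℝ] RKHS Q) : Prop :=
  ∀ z ∈ S.adjointGenerator, RKHS.embed Q (B (RKHS.iStar Q z.1)) = Qinf z.2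

/-- The graph of the operator `L_2`: `u ∈ D(L_2)` and `L_2 u = g` if and only if
`u ∈ W^{1,2}_H(X, ν)`, `g ∈ L²(X, ν)` and `-∫ [B D_H u, D_H v]_H dν = -∫ g v dν` for all
cylindrical functions `v`. -/
def ouGraph [MeasurableSpace X] (Q : PosSymOp X) (B : RKHS Q →L[ℝ] RKHS Q) (ν : Measure X) :
    Set (Lp ℝ 2 ν × Lp ℝ 2 ν) :=
  {z | ∃ F : Lp (RKHS Q) 2 ν, (z.1, F) ∈ sobolevGraph Q ν 2 ∧
    ∀ v ∈ cylindrical X,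
      -∫ x, inner ℝ (B (F x)) (gradCyl Q v x) ∂ν = -∫ x, z.2 x * v x ∂ν}

/-- `T` is the extension `(T_p(t))` to `L^p(X, ν)` of the semigroup `T₂ = (T_2(t))` on
`L²(X, ν)`: a strongly continuous semigroup of positive contractions which agrees with `T₂` on
`L^p(X, ν) ∩ L²(X, ν)`. -/
structure IsLpExtension [MeasurableSpace X] {ν : Measure X} (T₂ : C0Semigroup (Lp ℝ 2 ν))
    (p : ℝ≥0∞) [Fact (1 ≤ p)] (T : C0Semigroup (Lp ℝ p ν)) : Prop where
  contraction : T.IsContraction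
  positive : ∀ (t : ℝ≥0) (f : Lp ℝ p ν), 0 ≤ f → 0 ≤ T.toFun t f
  consistent : ∀ (t : ℝ≥0) (f : Lp ℝ 2 ν) (g : Lp ℝ p ν), f =ᵐ[ν] g →
    T₂.toFun t f =ᵐ[ν] T.toFun t g

end Setting

end WeightedOU

/-! The engine is the Lyapunov equation `lyapunov`, 2⟨Q_∞ x', A^* x'⟩ = -⟨Q x', x'⟩ on D(A^*). As
the vectors i^* x' with x' ∈ D(A^*) are dense in H, it turns into -[B h, h] = |h|²/2 for every h ∈ H
(`exists_driftOperator`). The form defining L_2 need not be symmetric, but its diagonal is exactly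
half the squared norm of the gradient.

Let Γ be the closure in L² × L²(H) of the graph of D_H on cylindrical functions. Lax-Milgram on the
Hilbert space Γ solves l u - L_2 u = l f with ‖u‖ ≤ ‖f‖ (`exists_isResolvent_formGraph`); the
argument works with Γ as a closed subspace and never needs it to be the graph of a function. The
Hille-Yosida theorem (`IsResolvent.exists_semigroup`) gives T_2, and adds that every closed convex
set invariant under all l (l - L_2)⁻¹ is invariant under T_2.

The L^p theory rests on one relation: u = l (l - L_2)⁻¹ f satisfies ∫ (u - s)⁺ ≤ ∫ (f - s)⁺ for all
real s. To see this, test the equation with ψ(u), ψ increasing: l ∫ (u - f) ψ(u) = ∫ ψ'(u) [B D_H u,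
D_H u] ≤ 0, and let ψ tend to the indicator of (s, ∞). The inequality cuts out a closed convex set,
so it passes to T_2 (`exists_ouSemigroup`). Applied to f and -f it yields positivity, the L^∞ bound
and, by integrating in s against s^(p-2), contractivity in every L^p with 1 < p < ∞
(`Majorized.eLpNorm_le`), with no duality or interpolation of operators.

The weighted measure is finite because the convex function U has an affine minorant and exponentials
of functionals are Gaussian integrable. Hence L^q ⊂ L^p for p < q; this inclusion intertwines the
semigroups, so it maps generator into generator (`C0Semigroup.map_mem_generator`). For p ≥ 2 the
same inclusion into L² and the energy identity ‖D_H u‖²/2 = -⟨L_2 u, u⟩ give the embedding in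
W^{1,2}. -/

namespace WeightedOU

/-! ### The Hille-Yosida theorem for contraction semigroups -/

section HilleYosida

variable {E : Type*} [NormedAddCommGroup E] [NormedSpace ℝ E] [CompleteSpace E]

omit [CompleteSpace E] in
theorem isClosed_setOf_continuous_orbit {ι : Type*} [TopologicalSpace ι] {T : ι → E →L[ℝ] E}
    (hT : ∀ t x, ‖T t x‖ ≤ ‖x‖) : IsClosed {x : E | Continuous fun t => T t x} := by
  refine isClosed_of_closure_subset fun x hx => ?_
  obtain ⟨y, hy, hyx⟩ := mem_closure_iff_seq_limit.1 hx
  refine TendstoUniformly.continuous (F := fun n t => T t (y n)) (p := atTop) ?_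
    (Frequently.of_forall hy)
  rw [Metric.tendstoUniformly_iff]
  intro ε hε
  filter_upwards [Metric.tendsto_nhds.1 hyx ε hε] with n hn t
  rw [dist_comm, dist_eq_norm] at hn
  rw [dist_eq_norm, ← map_sub]
  exact (hT t _).trans_lt hn

/-- e^{c(P-1)} = e^{-c} Σ c^k P^k / k! is a Poisson average of the powers of P, hence a limit of
convex combinations of points P^k x of K. -/
theorem exp_smul_sub_one_apply_mem {K : Set E} (hK : IsClosed K) (hKc : Convex ℝ K)
    {P : E →L[ℝ] E} (hP : Set.MapsTo P K K) {c : ℝ} (hc : 0 ≤ c) {x : E} (hx : x ∈ K) :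
    NormedSpace.exp (c • (P - 1)) x ∈ K := by
  have hpow : ∀ k : ℕ, (P ^ k) x ∈ K := by
    intro k
    induction k with
    | zero => simpa using hx
    | succ k ih => rw [pow_succ']; exact hP ih
  have hs : HasSum (fun k : ℕ => ((k.factorial : ℝ)⁻¹ * c ^ k) • (P ^ k) x)
      (NormedSpace.exp (c • P) x) := by
    have h := (NormedSpace.exp_series_hasSum_exp' (𝕂 := ℝ) (c • P)).mapL
      (ContinuousLinearMap.apply ℝ E x)
    simpa [Function.comp_def, smul_pow, smul_smul] using h
  have hr : HasSum (fun k : ℕ => (k.factorial : ℝ)⁻¹ * c ^ k) (Real.exp c) := by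
    have h := NormedSpace.exp_series_hasSum_exp' (𝕂 := ℝ) c
    simpa [Real.exp_eq_exp_ℝ] using h
  -- The partial sums are normalised by their own total weight, which tends to e^c; with `n + 1`
  -- terms the weight 1 of k = 0 is always present, so the total is positive.
  have hlim : Tendsto (fun n : ℕ => (Finset.range (n + 1)).centerMass
      (fun k : ℕ => (k.factorial : ℝ)⁻¹ * c ^ k) fun k => (P ^ k) x) atTop
      (𝓝 ((Real.exp c)⁻¹ • NormedSpace.exp (c • P) x)) := by
    have h1 := (hr.tendsto_sum_nat.comp (tendsto_add_atTop_nat 1)).inv₀ (Real.exp_ne_zero c)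
    exact h1.smul (hs.tendsto_sum_nat.comp (tendsto_add_atTop_nat 1))
  have hmem : (Real.exp c)⁻¹ • NormedSpace.exp (c • P) x ∈ K := by
    refine hK.mem_of_tendsto hlim (Eventually.of_forall fun n => ?_)
    refine hKc.centerMass_mem (fun i _ => by positivity) ?_ fun i _ => hpow i
    rw [Finset.sum_range_succ']
    have : 0 ≤ ∑ k ∈ Finset.range n, ((k + 1).factorial : ℝ)⁻¹ * c ^ (k + 1) :=
      Finset.sum_nonneg fun i _ => by positivity
    simp only [Nat.factorial_zero, Nat.cast_one, inv_one, pow_zero, mul_one]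
    linarith
  have hexp : NormedSpace.exp (c • (P - 1)) =
      (Real.exp c)⁻¹ • NormedSpace.exp (c • P) := by
    let _ : NormedAlgebra ℚ (E →L[ℝ] E) := NormedAlgebra.restrictScalars ℚ ℝ (E →L[ℝ] E)
    have h1 : c • (P - 1) = algebraMap ℝ (E →L[ℝ] E) (-c) + c • P := by
      rw [Algebra.algebraMap_eq_smul_one, smul_sub, neg_smul]; abel
    rw [h1, NormedSpace.exp_add_of_commute (Algebra.commutes _ _),
      ← NormedSpace.algebraMap_exp_comm, ← Real.exp_eq_exp_ℝ, Real.exp_neg,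
      Algebra.algebraMap_eq_smul_one, smul_one_mul]
  rw [hexp]
  exact hmem

/-- `J l = l (l - A)⁻¹` for the operator `A` with graph `G`, which has a dense domain, and these
operators are contractions. -/
structure IsResolvent (G : Set (E × E)) (J : ℝ → E →L[ℝ] E) : Prop where
  mem_iff : ∀ l : ℝ, 0 < l → ∀ f u : E, (u, l • (u - f)) ∈ G ↔ u = J l f
  norm_le : ∀ l : ℝ, 0 < l → ∀ f : E, ‖J l f‖ ≤ ‖f‖
  dense : Dense {u : E | ∃ g, (u, g) ∈ G}

/-- The Yosida approximation `l (J l - 1)` of the operator with resolvent `J l`. -/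
def yosidaGen (J : ℝ → E →L[ℝ] E) (l : ℝ) : E →L[ℝ] E := l • (J l - 1)

/-- The semigroup generated by the Yosida approximation. -/
noncomputable def yosida (J : ℝ → E →L[ℝ] E) (l t : ℝ) : E →L[ℝ] E :=
  NormedSpace.exp (t • yosidaGen J l)

theorem hasDerivAt_yosida (J : ℝ → E →L[ℝ] E) (l t : ℝ) :
    HasDerivAt (yosida J l) (yosida J l t * yosidaGen J l) t :=
  hasDerivAt_exp_smul_const (𝕂 := ℝ) (yosidaGen J l) t

theorem yosida_zero (J : ℝ → E →L[ℝ] E) (l : ℝ) : yosida J l 0 = 1 := by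
  simp [yosida, NormedSpace.exp_zero]

theorem yosida_add (J : ℝ → E →L[ℝ] E) (l s t : ℝ) :
    yosida J l (s + t) = yosida J l s * yosida J l t := by
  let _ : NormedAlgebra ℚ (E →L[ℝ] E) := NormedAlgebra.restrictScalars ℚ ℝ (E →L[ℝ] E)
  rw [yosida, add_smul, NormedSpace.exp_add_of_commute]
  · rfl
  · exact ((Commute.refl _).smul_left _).smul_right _

namespace IsResolvent

variable {G : Set (E × E)} {J : ℝ → E →L[ℝ] E} (hJ : IsResolvent G J)

include hJ

/-- Reading J_l f as a solution at the parameter m gives the resolvent identity `key`. Its two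
instances, for (l, m) and (m, l), combine to (1 - l/m) times the commutator equal to zero. -/
theorem commute {l m : ℝ} (hl : 0 < l) (hm : 0 < m) : Commute (J l) (J m) := by
  have key : ∀ {l m : ℝ}, 0 < l → 0 < m → ∀ f : E,
      J m (J l f) - (l / m) • (J m (J l f) - J m f) = J l f := by
    intro l m hl hm f
    have h1 : (J l f, l • (J l f - f)) ∈ G := (hJ.mem_iff l hl f _).2 rfl
    have h2 : (J l f, m • (J l f - (J l f - (l / m) • (J l f - f)))) ∈ G := by
      convert h1 using 2
      rw [sub_sub_cancel, smul_smul, mul_div_cancel₀ _ hm.ne']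
    have h3 := (hJ.mem_iff m hm _ _).1 h2
    rw [map_sub, map_smul, map_sub] at h3
    exact h3.symm
  rcases eq_or_ne l m with rfl | hne
  · exact Commute.refl _
  ext f
  change J l (J m f) = J m (J l f)
  have h1 := key hl hm f
  have h2 := key hm hl f
  have h3 : (1 - l / m) • (J m (J l f) - J l (J m f)) = 0 := by
    have h4 : J l f = J m (J l f) - (l / m) • (J m (J l f) - J m f) := h1.symm
    have h5 : (l / m) • (J l (J m f)) - (J l (J m f) - J l f) = (l / m) • J m f := by
      conv_rhs => rw [← h2]
      rw [smul_sub, smul_smul, div_mul_div_cancel₀ hm.ne', div_self hl.ne', one_smul]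
    rw [smul_sub, ← h5] at h4
    rw [sub_smul, smul_sub, one_smul, one_smul, smul_sub]
    have h6 := sub_eq_zero.2 h4
    rw [← neg_eq_zero, ← h6]
    abel
  have h7 : (1 - l / m) ≠ 0 := by
    intro h
    apply hne
    field_simp at h
    linarith
  exact (sub_eq_zero.1 ((smul_eq_zero.1 h3).resolve_left h7)).symm

theorem yosidaGen_apply {l : ℝ} (hl : 0 < l) {u g : E} (h : (u, g) ∈ G) :
    yosidaGen J l u = J l g := by
  have h1 : (u, l • (u - (u - l⁻¹ • g))) ∈ G := by
    convert h using 2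
    rw [sub_sub_cancel, smul_smul, mul_inv_cancel₀ hl.ne', one_smul]
  have h2 := (hJ.mem_iff l hl _ _).1 h1
  rw [map_sub, map_smul] at h2
  have h3 : J l u - u = l⁻¹ • J l g := by
    rw [sub_eq_iff_eq_add, add_comm, ← sub_eq_iff_eq_add, ← h2]
  change l • (J l u - u) = J l g
  rw [h3, smul_smul, mul_inv_cancel₀ hl.ne', one_smul]

theorem yosida_mem {K : Set E} (hK : IsClosed K) (hKc : Convex ℝ K) {l : ℝ} (hl : 0 < l)
    (hP : Set.MapsTo (J l) K K) {t : ℝ} (ht : 0 ≤ t) {x : E} (hx : x ∈ K) :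
    yosida J l t x ∈ K := by
  rw [yosida, yosidaGen, smul_smul]
  exact exp_smul_sub_one_apply_mem hK hKc hP (by positivity) hx

theorem norm_yosida_le {l : ℝ} (hl : 0 < l) {t : ℝ} (ht : 0 ≤ t) (x : E) :
    ‖yosida J l t x‖ ≤ ‖x‖ := by
  have := hJ.yosida_mem (K := Metric.closedBall 0 ‖x‖) Metric.isClosed_closedBall
    (convex_closedBall _ _) hl (fun y hy => ?_) ht (x := x) (by simp)
  · simpa using this
  · simp only [mem_closedBall_zero_iff] at hy ⊢
    exact (hJ.norm_le l hl y).trans hy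

/-- The path s ↦ e^{(t-s)A_m} e^{sA_l} x joins e^{tA_m} x to e^{tA_l} x; by commutation its velocity
is a contraction applied to (A_l - A_m) x. -/
theorem yosida_sub_le {l m : ℝ} (hl : 0 < l) (hm : 0 < m) {t : ℝ} (ht : 0 ≤ t) (x : E) :
    ‖yosida J l t x - yosida J m t x‖ ≤ t * ‖yosidaGen J l x - yosidaGen J m x‖ := by
  have hcomm : Commute (yosidaGen J l) (yosidaGen J m) :=
    (((hJ.commute hl hm).sub_left (Commute.one_left _)).sub_right
      ((Commute.one_right _).sub_left (Commute.one_left _))).smul_left l |>.smul_right m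
  have hc2 : ∀ s : ℝ, Commute (yosidaGen J m) (yosida J l s) := fun s =>
    (hcomm.symm.smul_right s).exp_right
  have hd : ∀ s : ℝ, HasDerivAt (fun s => (yosida J m (t - s) * yosida J l s) x)
      ((yosida J m (t - s) * yosida J l s) (yosidaGen J l x - yosidaGen J m x)) s := by
    intro s
    have h1 : HasDerivAt (fun s => yosida J m (t - s))
        (-(yosida J m (t - s) * yosidaGen J m)) s := by
      simpa [Function.comp_def] using
        (hasDerivAt_yosida J m (t - s)).scomp s ((hasDerivAt_id s).const_sub t)
    have h2 : HasDerivAt (fun s => (yosida J m (t - s) * yosida J l s) x) _ s :=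
      (h1.mul (hasDerivAt_yosida J l s)).clm_apply (hasDerivAt_const s x)
    convert h2 using 1
    have h3 : (yosida J m (t - s) * yosidaGen J m) * yosida J l s =
        (yosida J m (t - s) * yosida J l s) * yosidaGen J m := by
      rw [mul_assoc, (hc2 s).eq, mul_assoc]
    rw [neg_mul, h3, map_zero, add_zero, ← mul_assoc, map_sub]
    simp only [add_apply, neg_apply]
    exact (neg_add_eq_sub _ _).symm
  have h := norm_image_sub_le_of_norm_deriv_le_segment'
    (f := fun s => (yosida J m (t - s) * yosida J l s) x) (a := 0) (b := t)
    (C := ‖yosidaGen J l x - yosidaGen J m x‖)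
    (fun s _ => (hd s).hasDerivWithinAt) (fun s hs => ?_) t ⟨ht, le_rfl⟩
  · simpa [yosida_zero, mul_comm] using h
  · exact (hJ.norm_yosida_le hm (sub_nonneg.2 hs.2.le) _).trans (hJ.norm_yosida_le hl hs.1 _)

theorem norm_yosida_sub_le {l : ℝ} {t : ℝ} (ht : 0 ≤ t) (x y : E) {C : ℝ}
    (hC : ∀ s ∈ Set.Ico 0 t, ‖yosida J l s (yosidaGen J l x) - y‖ ≤ C) :
    ‖yosida J l t x - x - t • y‖ ≤ C * t := by
  have hd : ∀ s : ℝ, HasDerivAt (fun s => yosida J l s x - s • y)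
      (yosida J l s (yosidaGen J l x) - y) s := by
    intro s
    have h2 : HasDerivAt (fun s => yosida J l s x - s • y) _ s :=
      ((hasDerivAt_yosida J l s).clm_apply (hasDerivAt_const s x)).sub
        ((hasDerivAt_id s).smul_const y)
    convert h2 using 1
    rw [map_zero, add_zero, one_smul]
    rfl
  have h := norm_image_sub_le_of_norm_deriv_le_segment' (a := 0) (b := t)
    (fun s _ => (hd s).hasDerivWithinAt) hC t ⟨ht, le_rfl⟩
  simp only [yosida_zero, zero_smul, sub_zero, one_apply_eq_self] at h
  rwa [sub_right_comm] at h

theorem norm_yosida_sub_self_le {l : ℝ} (hl : 0 < l) {t : ℝ} (ht : 0 ≤ t) (x : E) :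
    ‖yosida J l t x - x‖ ≤ ‖yosidaGen J l x‖ * t := by
  have := hJ.norm_yosida_sub_le (l := l) ht x 0 (C := ‖yosidaGen J l x‖) fun s hs => by
    simpa using hJ.norm_yosida_le hl hs.1 _
  simpa using this

/-- On the domain, J_l u - u = l⁻¹ J_l g is of order 1/l; uniform contractivity extends the
convergence to the closure of the domain, which is the whole space. -/
theorem tendsto_apply (x : E) : Tendsto (fun n : ℕ => J (n + 1) x) atTop (𝓝 x) := by
  have hpos : ∀ n : ℕ, (0 : ℝ) < n + 1 := fun n => by positivity
  have hcl : IsClosed {x : E | Tendsto (fun n : ℕ => J (n + 1) x) atTop (𝓝 x)} := by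
    refine isClosed_of_closure_subset fun x hx => ?_
    rw [Set.mem_ofPred_eq, Metric.tendsto_atTop]
    intro ε hε
    obtain ⟨y, hy, hxy⟩ := Metric.mem_closure_iff.1 hx (ε / 3) (by positivity)
    obtain ⟨N, hN⟩ := Metric.tendsto_atTop.1 hy (ε / 3) (by positivity)
    refine ⟨N, fun n hn => ?_⟩
    have h1 : dist (J (n + 1) x) (J (n + 1) y) ≤ dist x y := by
      rw [dist_eq_norm, ← map_sub, dist_eq_norm]
      exact hJ.norm_le _ (hpos n) _
    have h2 := hN n hn
    have h3 := dist_triangle4_right (J (n + 1) x) x (J (n + 1) y) y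
    linarith
  have hsub : {u : E | ∃ g, (u, g) ∈ G} ⊆
      {x : E | Tendsto (fun n : ℕ => J (n + 1) x) atTop (𝓝 x)} := by
    rintro u ⟨g, hg⟩
    rw [Set.mem_ofPred_eq, tendsto_iff_norm_sub_tendsto_zero]
    have hbound : ∀ n : ℕ, ‖J (n + 1) u - u‖ ≤ 1 / ((n : ℝ) + 1) * ‖g‖ := by
      intro n
      have h1 := hJ.yosidaGen_apply (hpos n) hg
      change ((n : ℝ) + 1) • (J (n + 1) u - u) = _ at h1
      have h2 : J (n + 1) u - u = (1 / ((n : ℝ) + 1)) • J (n + 1) g := by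
        rw [← h1, smul_smul, one_div, inv_mul_cancel₀ (hpos n).ne', one_smul]
      rw [h2, norm_smul, Real.norm_of_nonneg (by positivity)]
      gcongr
      exact hJ.norm_le _ (hpos n) _
    refine squeeze_zero (fun _ => norm_nonneg _) hbound ?_
    simpa using tendsto_one_div_add_atTop_nhds_zero_nat.mul_const ‖g‖
  exact closure_minimal hsub hcl (hJ.dense x)

theorem tendsto_yosidaGen {u g : E} (h : (u, g) ∈ G) :
    Tendsto (fun n : ℕ => yosidaGen J (n + 1) u) atTop (𝓝 g) := by
  refine (hJ.tendsto_apply g).congr fun n => ?_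
  rw [hJ.yosidaGen_apply (by positivity) h]

theorem cauchySeq_yosida {t : ℝ} (ht : 0 ≤ t) (x : E) :
    CauchySeq fun n : ℕ => yosida J (n + 1) t x := by
  have hpos : ∀ n : ℕ, (0 : ℝ) < n + 1 := fun n => by positivity
  rw [Metric.cauchySeq_iff']
  intro ε hε
  obtain ⟨y, ⟨g, hg⟩, hxy⟩ := Metric.mem_closure_iff.1 (hJ.dense x) (ε / 3) (by positivity)
  obtain ⟨N, hN⟩ := Metric.cauchySeq_iff'.1 (hJ.tendsto_yosidaGen hg).cauchySeq
    (ε / 3 / (t + 1)) (by positivity)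
  refine ⟨N, fun n hn => ?_⟩
  have h1 : ∀ n : ℕ, dist (yosida J (n + 1) t x) (yosida J (n + 1) t y) ≤ dist x y := by
    intro n
    rw [dist_eq_norm, ← map_sub, dist_eq_norm]
    exact hJ.norm_yosida_le (hpos n) ht _
  have h2 : dist (yosida J (n + 1) t y) (yosida J (N + 1) t y) < ε / 3 := by
    rw [dist_eq_norm]
    refine (hJ.yosida_sub_le (hpos n) (hpos N) ht y).trans_lt ?_
    have h3 := hN n hn
    rw [dist_eq_norm, lt_div_iff₀ (by positivity)] at h3
    have h4 := norm_nonneg (yosidaGen J (↑n + 1) y - yosidaGen J (↑N + 1) y)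
    nlinarith
  have h3 := dist_triangle4 (yosida J (n + 1) t x) (yosida J (n + 1) t y)
    (yosida J (N + 1) t y) (yosida J (N + 1) t x)
  have h4 := h1 N
  rw [dist_comm] at h4
  linarith [h1 n]

theorem exists_tendsto_yosida (t : ℝ≥0) : ∃ T : E →L[ℝ] E, ∀ x : E,
    Tendsto (fun n : ℕ => yosida J (n + 1) t x) atTop (𝓝 (T x)) := by
  choose T hT using fun x => cauchySeq_tendsto_of_complete (hJ.cauchySeq_yosida t.2 x)
  let L := linearMapOfTendsto T (fun n : ℕ => (yosida J (n + 1) t).toLinearMap)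
    (tendsto_pi_nhds.2 hT)
  refine ⟨L.mkContinuous 1 fun x => ?_, fun x => hT x⟩
  rw [one_mul]
  exact le_of_tendsto (hT x).norm
    (Eventually.of_forall fun n => hJ.norm_yosida_le (by positivity) t.2 x)

/-- The semigroup is the strong limit of the Yosida semigroups, so bounds and invariant closed
convex sets pass to the limit. That the generator is no larger than G follows from the solvability
of u - Au = f together with contractivity. -/
theorem exists_semigroup : ∃ S : C0Semigroup E, S.IsContraction ∧ S.generator = G ∧
    ∀ K : Set E, IsClosed K → Convex ℝ K → (∀ l : ℝ, 0 < l → Set.MapsTo (J l) K K) →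
      ∀ t : ℝ≥0, Set.MapsTo (S.toFun t) K K := by
  have hpos : ∀ n : ℕ, (0 : ℝ) < n + 1 := fun n => by positivity
  choose T hT using hJ.exists_tendsto_yosida
  have hle : ∀ t x, ‖T t x‖ ≤ ‖x‖ := fun t x => le_of_tendsto (hT t x).norm
    (Eventually.of_forall fun n => hJ.norm_yosida_le (hpos n) t.2 x)
  have hadd : ∀ s t x, T (s + t) x = T s (T t x) := by
    intro s t x
    refine tendsto_nhds_unique (hT (s + t) x) ?_
    have h1 : Tendsto (fun n : ℕ => yosida J (n + 1) s (yosida J (n + 1) t x - T t x)) atTop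
        (𝓝 0) := by
      refine squeeze_zero_norm (fun n => hJ.norm_yosida_le (hpos n) s.2 _) ?_
      simpa using (tendsto_iff_norm_sub_tendsto_zero.1 (hT t x))
    have h2 := h1.add (hT s (T t x))
    rw [zero_add] at h2
    refine h2.congr fun n => ?_
    rw [map_sub, sub_add_cancel, NNReal.coe_add, yosida_add]
    rfl
  have hzero : T 0 = ContinuousLinearMap.id ℝ E := by
    ext x
    refine tendsto_nhds_unique (hT 0 x) ?_
    simp [yosida_zero]
  have hself : ∀ t : ℝ≥0, ∀ u g, (u, g) ∈ G → ‖T t u - u‖ ≤ ‖g‖ * t := fun t u g h =>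
    le_of_tendsto_of_tendsto ((hT t u).sub_const u).norm
      ((hJ.tendsto_yosidaGen h).norm.mul_const _)
      (Eventually.of_forall fun n => hJ.norm_yosida_sub_self_le (hpos n) t.2 u)
  have hlip : ∀ u g, (u, g) ∈ G → ∀ s r : ℝ≥0, ‖T (s + r) u - T s u‖ ≤ ‖g‖ * r := by
    intro u g h s r
    rw [hadd, ← map_sub]
    exact (hle _ _).trans (hself r u g h)
  have hcont : ∀ x, Continuous fun t => T t x := by
    have hsub : {u : E | ∃ g, (u, g) ∈ G} ⊆ {x : E | Continuous fun t => T t x} := by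
      rintro u ⟨g, hg⟩
      refine (LipschitzWith.of_dist_le_mul (K := ‖g‖₊) fun s t => ?_).continuous
      wlog hst : s ≤ t generalizing s t
      · rw [dist_comm, dist_comm s]; exact this t s (le_of_not_ge hst)
      obtain ⟨r, rfl⟩ := exists_add_of_le hst
      have h1 := hlip u g hg s r
      rw [dist_comm, dist_eq_norm, NNReal.dist_eq]
      simpa using h1
    exact fun x => closure_minimal hsub (isClosed_setOf_continuous_orbit hle) (hJ.dense x)
  let S : C0Semigroup E := ⟨T, hzero, fun s t => by ext x; exact hadd s t x, hcont⟩
  have hgen : G ⊆ S.generator := by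
    rintro ⟨u, g⟩ hg
    -- Differentiability at 0 for u in the domain, estimated before letting n → ∞. Replacing g by a
    -- nearby v in the domain makes the deviation of the orbit of g linear in t, uniformly in n; the
    -- replacement is paid twice, hence ε / 4.
    have hrate : ∀ ε > 0, ∀ᶠ t : ℝ≥0 in 𝓝[>] 0, ‖T t u - u - (t : ℝ) • g‖ ≤ ε * t := by
      intro ε hε
      obtain ⟨v, ⟨w, hw⟩, hgv⟩ := Metric.mem_closure_iff.1 (hJ.dense g) (ε / 4) (by positivity)
      rw [dist_eq_norm] at hgv
      have hbound : ∀ t : ℝ≥0, ‖T t u - u - (t : ℝ) • g‖ ≤ (2 * ‖g - v‖ + ‖w‖ * t) * t := by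
        intro t
        have hn : ∀ n : ℕ, ‖yosida J (n + 1) t u - u - (t : ℝ) • g‖ ≤
            (‖yosidaGen J (n + 1) u - g‖ + 2 * ‖g - v‖ + ‖yosidaGen J (n + 1) v‖ * t) * t := by
          intro n
          refine hJ.norm_yosida_sub_le t.2 u g fun s hs => ?_
          have e : yosida J (n + 1) s (yosidaGen J (n + 1) u) - g =
              yosida J (n + 1) s (yosidaGen J (n + 1) u - g) + yosida J (n + 1) s (g - v)
                + (yosida J (n + 1) s v - v) - (g - v) := by
            simp only [map_sub]; abel
          have h1 := hJ.norm_yosida_le (hpos n) hs.1 (yosidaGen J (n + 1) u - g)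
          have h2 := hJ.norm_yosida_le (hpos n) hs.1 (g - v)
          have h3 := hJ.norm_yosida_sub_self_le (hpos n) hs.1 v
          have h4 : ‖yosidaGen J (n + 1) v‖ * s ≤ ‖yosidaGen J (n + 1) v‖ * t :=
            mul_le_mul_of_nonneg_left hs.2.le (norm_nonneg _)
          rw [e]
          refine (norm_sub_le _ _).trans ?_
          have h5 := norm_add₃_le (a := yosida J (n + 1) s (yosidaGen J (n + 1) u - g))
            (b := yosida J (n + 1) s (g - v)) (c := yosida J (n + 1) s v - v)
          linarith
        have hl : Tendsto (fun n : ℕ => (‖yosidaGen J (n + 1) u - g‖ + 2 * ‖g - v‖ +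
            ‖yosidaGen J (n + 1) v‖ * t) * (t : ℝ)) atTop
            (𝓝 ((‖g - g‖ + 2 * ‖g - v‖ + ‖w‖ * t) * t)) :=
          ((((hJ.tendsto_yosidaGen hg).sub_const g).norm.add_const _).add
            ((hJ.tendsto_yosidaGen hw).norm.mul_const _)).mul_const _
        rw [sub_self, norm_zero, zero_add] at hl
        exact le_of_tendsto_of_tendsto (((hT t u).sub_const u).sub_const _).norm hl
          (Eventually.of_forall hn)
      have hsmall : ∀ᶠ t : ℝ≥0 in 𝓝[>] 0, ‖w‖ * (t : ℝ) < ε / 2 := by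
        refine Tendsto.eventually_lt_const (v := 0) (by positivity) ?_
        refine tendsto_nhdsWithin_of_tendsto_nhds ?_
        have : Continuous fun t : ℝ≥0 => ‖w‖ * (t : ℝ) := by fun_prop
        simpa using this.tendsto 0
      filter_upwards [hsmall] with t ht
      refine (hbound t).trans (mul_le_mul_of_nonneg_right ?_ t.2)
      linarith
    change Tendsto (fun t : ℝ≥0 => (t : ℝ)⁻¹ • (T t u - u)) (𝓝[>] 0) (𝓝 g)
    rw [Metric.tendsto_nhds]
    intro ε hε
    filter_upwards [hrate (ε / 2) (by positivity), self_mem_nhdsWithin] with t ht ht0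
    have ht0' : (0 : ℝ) < t := ht0
    have e : (t : ℝ)⁻¹ • (T t u - u) - g = (t : ℝ)⁻¹ • (T t u - u - (t : ℝ) • g) := by
      rw [smul_sub _ (T t u - u), smul_smul, inv_mul_cancel₀ ht0'.ne', one_smul]
    rw [dist_eq_norm, e, norm_smul, norm_inv, Real.norm_of_nonneg ht0'.le,
      inv_mul_lt_iff₀ ht0']
    nlinarith
  refine ⟨S, fun t => (T t).opNorm_le_bound zero_le_one fun x => by simpa using hle t x, ?_, ?_⟩
  · refine Set.Subset.antisymm ?_ hgen
    rintro ⟨x, y⟩ hxy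
    -- u solves u - Au = x - y, so x - u would satisfy A(x - u) = x - u. If it were nonzero, T(t)(x
    -- - u) ≈ (1 + t)(x - u) would contradict contractivity for small t.
    have hu : (J 1 (x - y), (1 : ℝ) • (J 1 (x - y) - (x - y))) ∈ G :=
      (hJ.mem_iff 1 one_pos _ _).2 rfl
    set u := J 1 (x - y) with hu_def
    rw [one_smul] at hu
    have hw : Tendsto (fun t : ℝ≥0 => (t : ℝ)⁻¹ • (T t (x - u) - (x - u))) (𝓝[>] 0)
        (𝓝 (x - u)) := by
      have h1 : Tendsto (fun t : ℝ≥0 => (t : ℝ)⁻¹ • (T t x - x)) (𝓝[>] 0) (𝓝 y) := hxy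
      have h2 : Tendsto (fun t : ℝ≥0 => (t : ℝ)⁻¹ • (T t u - u)) (𝓝[>] 0)
        (𝓝 (u - (x - y))) := hgen hu
      have h3 := h1.sub h2
      rw [show y - (u - (x - y)) = x - u by abel] at h3
      refine h3.congr fun t => ?_
      rw [map_sub, ← smul_sub]
      congr 1
      abel
    have hzero : x - u = 0 := by
      by_contra hne
      have hn : 0 < ‖x - u‖ := norm_pos_iff.2 hne
      obtain ⟨t, ht, ht0⟩ := ((Metric.tendsto_nhds.1 hw _ hn).and self_mem_nhdsWithin).exists
      have ht0' : (0 : ℝ) < t := ht0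
      rw [dist_eq_norm] at ht
      have e : T t (x - u) = (1 + (t : ℝ)) • (x - u) +
          (t : ℝ) • ((t : ℝ)⁻¹ • (T t (x - u) - (x - u)) - (x - u)) := by
        rw [smul_sub _ (_ • _), smul_smul, mul_inv_cancel₀ ht0'.ne', one_smul, add_smul, one_smul]
        abel
      have h1 : ‖(1 + (t : ℝ)) • (x - u)‖ ≤ ‖T t (x - u)‖ +
          ‖(t : ℝ) • ((t : ℝ)⁻¹ • (T t (x - u) - (x - u)) - (x - u))‖ := by
        rw [eq_sub_of_add_eq e.symm]
        exact norm_sub_le _ _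
      rw [norm_smul, norm_smul, Real.norm_of_nonneg (by positivity),
        Real.norm_of_nonneg ht0'.le] at h1
      have h2 := hle t (x - u)
      have h3 := mul_lt_mul_of_pos_left ht ht0'
      linarith
    have hx : x = u := sub_eq_zero.1 hzero
    rw [← hx, show x - (x - y) = y by abel] at hu
    exact hu
  · intro K hK hKc hJK t x hx
    exact hK.mem_of_tendsto (hT t x)
      (Eventually.of_forall fun n => hJ.yosida_mem hK hKc (hpos n) (hJK _ (hpos n)) t.2 hx)

end IsResolvent

end HilleYosida

end WeightedOU

namespace WeightedOU

/-! ### The operator associated with a dissipative form -/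

section Form

variable {E F : Type*} [NormedAddCommGroup E] [InnerProductSpace ℝ E]
  [NormedAddCommGroup F] [InnerProductSpace ℝ F]

/-- The graph of the operator `L` with `⟨L u, v⟩ = ⟨b D u, D v⟩` for all `v ∈ D(D)`, where `Γ` is
the graph of `D`. -/
def formGraph (Γ : Submodule ℝ (E × F)) (b : F →L[ℝ] F) : Set (E × E) :=
  {z | ∃ G : F, (z.1, G) ∈ Γ ∧ ∀ w ∈ Γ, inner ℝ (b G) w.2 = inner ℝ z.2 w.1}

/-- Lax-Milgram on Γ with the Hilbert graph norm: by `hb` the form l⟨u, v⟩ - ⟨b Du, Dv⟩ is coercive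
with constant min(l, 1/2). -/
theorem exists_form_solution [CompleteSpace E] [CompleteSpace F] {Γ : Submodule ℝ (E × F)}
    (hΓ : IsClosed (Γ : Set (E × F))) {b : F →L[ℝ] F}
    (hb : ∀ G, -inner ℝ (b G) G = 1 / 2 * ‖G‖ ^ 2) {l : ℝ} (hl : 0 < l) :
    ∃ J : E →L[ℝ] E, ∀ f, ∃ G : F, (J f, G) ∈ Γ ∧
      ∀ w ∈ Γ, l * inner ℝ (J f) w.1 - inner ℝ (b G) w.2 = l * inner ℝ f w.1 := by
  let φ := WithLp.prodContinuousLinearEquiv 2 ℝ E F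
  let V : Submodule ℝ (WithLp 2 (E × F)) := Γ.comap φ.toLinearEquiv.toLinearMap
  have hV : IsClosed (V : Set (WithLp 2 (E × F))) := hΓ.preimage φ.continuous
  have : CompleteSpace V := hV.completeSpace_coe
  let p : V →L[ℝ] E := (ContinuousLinearMap.fst ℝ E F ∘L φ.toContinuousLinearMap) ∘L V.subtypeL
  let q : V →L[ℝ] F := (ContinuousLinearMap.snd ℝ E F ∘L φ.toContinuousLinearMap) ∘L V.subtypeL
  have hnorm : ∀ v : V, ‖v‖ ^ 2 = ‖p v‖ ^ 2 + ‖q v‖ ^ 2 := fun v =>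
    WithLp.prod_norm_sq_eq_of_L2 (v : WithLp 2 (E × F))
  -- `M` represents the form: p and q are the two coordinate projections of Γ.
  let M : V →L[ℝ] V := p.adjoint ∘L (l • p) - q.adjoint ∘L b ∘L q
  have hM : ∀ v w : V, inner ℝ (M v) w = l * inner ℝ (p v) (p w) - inner ℝ (b (q v)) (q w) := by
    intro v w
    change inner ℝ (p.adjoint (l • p v) - q.adjoint (b (q v))) w = _
    rw [inner_sub_left, ContinuousLinearMap.adjoint_inner_left, real_inner_smul_left,
      ContinuousLinearMap.adjoint_inner_left]
  have hcoer : IsCoercive ((innerSL ℝ : V →L[ℝ] V →L[ℝ] ℝ) ∘L M) := by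
    refine ⟨min l (1 / 2), by positivity, fun v => ?_⟩
    change _ ≤ inner ℝ (M v) v
    have h1 := hb (q v)
    rw [hM, real_inner_self_eq_norm_sq, mul_assoc, ← sq, hnorm, mul_add]
    have h2 : min l (1 / 2) * ‖p v‖ ^ 2 ≤ l * ‖p v‖ ^ 2 :=
      mul_le_mul_of_nonneg_right (min_le_left _ _) (sq_nonneg _)
    have h3 : min l (1 / 2) * ‖q v‖ ^ 2 ≤ 1 / 2 * ‖q v‖ ^ 2 :=
      mul_le_mul_of_nonneg_right (min_le_right _ _) (sq_nonneg _)
    linarith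
  let e := hcoer.continuousLinearEquivOfBilin
  have he : ∀ v w : V, inner ℝ (e v) w = inner ℝ (M v) w := fun v w =>
    hcoer.continuousLinearEquivOfBilin_apply v w
  refine ⟨p ∘L e.symm.toContinuousLinearMap ∘L p.adjoint ∘L (l • ContinuousLinearMap.id ℝ E), fun f => ?_⟩
  let v : V := e.symm (p.adjoint (l • f))
  refine ⟨q v, v.2, fun w hw => ?_⟩
  let w' : V := ⟨φ.symm w, by change φ (φ.symm w) ∈ Γ; simpa using hw⟩
  have h1 := he v w'
  rw [hM, ContinuousLinearEquiv.apply_symm_apply, ContinuousLinearMap.adjoint_inner_left,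
    real_inner_smul_left] at h1
  exact h1.symm

/-- Testing with the solution itself gives l‖u‖² + ‖G‖²/2 = l⟨f, u⟩. With f = 0 this also yields
uniqueness. -/
theorem norm_le_of_form_solution {Γ : Submodule ℝ (E × F)} {b : F →L[ℝ] F}
    (hb : ∀ G, -inner ℝ (b G) G = 1 / 2 * ‖G‖ ^ 2) {l : ℝ} (hl : 0 < l) {f u : E} {G : F}
    (hu : (u, G) ∈ Γ)
    (h : ∀ w ∈ Γ, l * inner ℝ u w.1 - inner ℝ (b G) w.2 = l * inner ℝ f w.1) : ‖u‖ ≤ ‖f‖ := by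
  have h1 := h _ hu
  have h2 := hb G
  simp only [real_inner_self_eq_norm_sq] at h1
  have h3 : ‖u‖ * ‖u‖ ≤ ‖f‖ * ‖u‖ := by
    refine le_trans ?_ (real_inner_le_norm f u)
    refine le_of_mul_le_mul_left ?_ hl
    nlinarith [sq_nonneg ‖G‖]
  by_contra hlt
  have := norm_nonneg f
  nlinarith

theorem exists_isResolvent_formGraph [CompleteSpace E] [CompleteSpace F]
    {Γ : Submodule ℝ (E × F)} (hΓ : IsClosed (Γ : Set (E × F))) {b : F →L[ℝ] F}
    (hb : ∀ G, -inner ℝ (b G) G = 1 / 2 * ‖G‖ ^ 2)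
    (hdense : ∀ f : E, (∀ w ∈ Γ, inner ℝ f w.1 = 0) → f = 0) :
    ∃ J : ℝ → E →L[ℝ] E, IsResolvent (formGraph Γ b) J ∧
      ∀ l : ℝ, 0 < l → ∀ f, ∃ G : F, (J l f, G) ∈ Γ ∧
        ∀ w ∈ Γ, l * inner ℝ (J l f) w.1 - inner ℝ (b G) w.2 = l * inner ℝ f w.1 := by
  have h0 : ∀ l : ℝ, ∃ J : E →L[ℝ] E, 0 < l → ∀ f, ∃ G : F, (J f, G) ∈ Γ ∧
      ∀ w ∈ Γ, l * inner ℝ (J f) w.1 - inner ℝ (b G) w.2 = l * inner ℝ f w.1 := by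
    intro l
    by_cases hl : 0 < l
    · obtain ⟨J, hJ⟩ := exists_form_solution hΓ hb hl
      exact ⟨J, fun _ => hJ⟩
    -- `IsResolvent` constrains only positive parameters, so any value serves here.
    · exact ⟨0, fun h => absurd h hl⟩
  choose J hJ using h0
  refine ⟨J, ⟨fun l hl f u => ?_, fun l hl f => ?_, ?_⟩, hJ⟩
  · have hequiv : ∀ (u : E) (G : F), (∀ w ∈ Γ, inner ℝ (b G) w.2 = inner ℝ (l • (u - f)) w.1) ↔
        ∀ w ∈ Γ, l * inner ℝ u w.1 - inner ℝ (b G) w.2 = l * inner ℝ f w.1 := by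
      intro u G
      refine forall₂_congr fun w _ => ?_
      rw [real_inner_smul_left, inner_sub_left]
      constructor <;> intro h <;> linarith
    obtain ⟨G₀, hG₀, h₀⟩ := hJ l hl f
    constructor
    · rintro ⟨G, hG, h⟩
      rw [hequiv] at h
      have hd : ‖u - J l f‖ ≤ ‖(0 : E)‖ := by
        refine norm_le_of_form_solution hb hl (G := G - G₀) (Γ.sub_mem hG hG₀) fun w hw => ?_
        have h1 := h w hw
        have h2 := h₀ w hw
        rw [inner_sub_left, map_sub, inner_sub_left, inner_zero_left]
        linarith
      rw [norm_zero, norm_le_zero_iff, sub_eq_zero] at hd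
      exact hd
    · rintro rfl
      exact ⟨G₀, hG₀, (hequiv _ _).2 h₀⟩
  · obtain ⟨G₀, hG₀, h₀⟩ := hJ l hl f
    exact norm_le_of_form_solution hb hl hG₀ h₀
  · have hsub : ((J 1).range : Set E) ⊆ {u : E | ∃ g, (u, g) ∈ formGraph Γ b} := by
      rintro _ ⟨f, rfl⟩
      obtain ⟨G, hG, h⟩ := hJ 1 one_pos f
      refine ⟨J 1 f - f, G, hG, fun w hw => ?_⟩
      have h1 := h w hw
      rw [inner_sub_left]
      change _ = inner ℝ (J 1 f) w.1 - _
      linarith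
    refine Dense.mono hsub ?_
    rw [Submodule.dense_iff_topologicalClosure_eq_top, Submodule.topologicalClosure_eq_top_iff,
      Submodule.eq_bot_iff]
    -- For f orthogonal to the range of J_1, testing the equation with its solution makes both J_1 f
    -- and its gradient vanish, so f is orthogonal to the first projection of Γ.
    intro f hf
    obtain ⟨G, hG, h⟩ := hJ 1 one_pos f
    have h1 := h _ hG
    have h2 : inner ℝ (J 1 f) f = (0 : ℝ) := (Submodule.mem_orthogonal _ _).1 hf _ ⟨f, rfl⟩
    have h3 := hb G
    simp only [real_inner_self_eq_norm_sq] at h1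
    rw [real_inner_comm (J 1 f) f, h2] at h1
    have h4 : ‖J 1 f‖ ^ 2 = 0 := by nlinarith [sq_nonneg ‖G‖, sq_nonneg ‖J 1 f‖]
    have h5 : ‖G‖ ^ 2 = 0 := by nlinarith [sq_nonneg ‖G‖, sq_nonneg ‖J 1 f‖]
    have h6 : J 1 f = 0 := by simpa using h4
    have h7 : G = 0 := by simpa using h5
    refine hdense f fun w hw => ?_
    have h8 := h w hw
    rw [h6, h7, map_zero, inner_zero_left, inner_zero_left] at h8
    linarith

/-- Energy identity: ‖G‖²/2 = -⟨g, u⟩ ≤ ‖u‖‖g‖, and 2‖u‖‖g‖ ≤ (‖u‖ + ‖g‖)². -/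
theorem norm_sq_le_of_mem_formGraph {Γ : Submodule ℝ (E × F)} {b : F →L[ℝ] F}
    (hb : ∀ G, -inner ℝ (b G) G = 1 / 2 * ‖G‖ ^ 2) {u g : E} (h : (u, g) ∈ formGraph Γ b) :
    ∃ G : F, (u, G) ∈ Γ ∧ ‖G‖ ≤ ‖u‖ + ‖g‖ := by
  obtain ⟨G, hG, h⟩ := h
  refine ⟨G, hG, ?_⟩
  have h1 := h _ hG
  have h2 := hb G
  have h3 := neg_le_of_abs_le (abs_real_inner_le_norm g u)
  dsimp only at h1
  refine abs_le_of_sq_le_sq' ?_ (by positivity) |>.2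
  nlinarith [sq_nonneg (‖u‖ - ‖g‖), sq_nonneg ‖u‖, sq_nonneg ‖g‖]

end Form

end WeightedOU

namespace WeightedOU

/-! ### Majorization -/

section Majorization

variable {α : Type*} [MeasurableSpace α] {ν : Measure α}

/-- `∫ (f - s)⁺ dν ≤ ∫ (g - s)⁺ dν` for all real `s`. -/
def Majorized (ν : Measure α) (f g : α → ℝ) : Prop :=
  ∀ s : ℝ, ∫ x, max (f x - s) 0 ∂ν ≤ ∫ x, max (g x - s) 0 ∂ν

theorem exists_abs_deriv_smoothTransition_le :
    ∃ C : ℝ, ∀ r : ℝ, |deriv Real.smoothTransition r| ≤ C := by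
  have hcont : Continuous (deriv Real.smoothTransition) :=
    (Real.smoothTransition.contDiff (n := 1)).continuous_deriv le_rfl
  refine hcont.bounded_above_of_compact_support
    (HasCompactSupport.intro (K := Set.Icc 0 1) isCompact_Icc fun r hr => ?_)
  rw [Set.mem_Icc, not_and_or, not_le, not_le] at hr
  rcases hr with hr | hr
  · have h : Real.smoothTransition =ᶠ[𝓝 r] fun _ => 0 := by
      filter_upwards [Iio_mem_nhds hr] with y hy
      exact Real.smoothTransition.zero_of_nonpos (Set.mem_Iio.1 hy).le
    rw [h.deriv_eq, deriv_const]
  · have h : Real.smoothTransition =ᶠ[𝓝 r] fun _ => 1 := by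
      filter_upwards [Ioi_mem_nhds hr] with y hy
      exact Real.smoothTransition.one_of_one_le (Set.mem_Ioi.1 hy).le
    rw [h.deriv_eq, deriv_const]

theorem integrable_posPart_sub [IsFiniteMeasure ν] {f : α → ℝ} (hf : Integrable f ν) (s : ℝ) :
    Integrable (fun x => max (f x - s) 0) ν :=
  (hf.sub (integrable_const s)).pos_part

/-- With ψ tending to the indicator χ of (s, ∞), the hypothesis gives ∫ (u - f) χ(u) ≤ 0, that is ∫
(u - s)⁺ ≤ ∫ (f - s) χ(u), and the last integrand is at most (f - s)⁺. -/
theorem majorized_of_test [IsFiniteMeasure ν] {f u : α → ℝ} (hf : Integrable f ν)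
    (hu : Integrable u ν)
    (h : ∀ ψ : ℝ → ℝ, ContDiff ℝ 1 ψ → Monotone ψ → (∃ C, ∀ r, |ψ r| ≤ C) →
      (∃ C, ∀ r, |deriv ψ r| ≤ C) → ∫ x, (u x - f x) * ψ (u x) ∂ν ≤ 0) :
    Majorized ν u f := by
  intro s
  let χ : ℝ → ℝ := fun r => if s < r then 1 else 0
  have hχ : Measurable χ := Measurable.ite measurableSet_Ioi measurable_const measurable_const
  have hχ1 : ∀ r, ‖χ r‖ ≤ 1 := fun r => by by_cases hr : s < r <;> simp [χ, hr]
  have hint : ∀ g : α → ℝ, Integrable g ν → Integrable (fun x => g x * χ (u x)) ν :=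
    fun g hg => hg.mul_bdd (c := 1)
      (hχ.comp_aemeasurable hu.aemeasurable).aestronglyMeasurable
      (Eventually.of_forall fun x => hχ1 _)
  have hlim : ∫ x, (u x - f x) * χ (u x) ∂ν ≤ 0 := by
    -- Smooth steps from 0 at s to 1 at s + 1/n; they vanish at s itself, so the limit is the
    -- indicator of the open half-line.
    let ψ : ℕ → ℝ → ℝ := fun n r => Real.smoothTransition ((n : ℝ) * (r - s))
    have hψc : ∀ n, ContDiff ℝ 1 (ψ n) := fun n =>
      (Real.smoothTransition.contDiff (n := 1)).comp
        (contDiff_const.mul (contDiff_id.sub contDiff_const))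
    have hψ1 : ∀ n r, |ψ n r| ≤ 1 := fun n r => by
      rw [abs_of_nonneg (Real.smoothTransition.nonneg _)]
      exact Real.smoothTransition.le_one _
    have hle : ∀ n, ∫ x, (u x - f x) * ψ n (u x) ∂ν ≤ 0 := by
      intro n
      refine h _ (hψc n) (fun a b hab => Real.smoothTransition.monotone (by gcongr))
        ⟨1, hψ1 n⟩ ?_
      obtain ⟨C, hC⟩ := exists_abs_deriv_smoothTransition_le
      refine ⟨C * n, fun r => ?_⟩
      have h1 : HasDerivAt (ψ n) (deriv Real.smoothTransition ((n : ℝ) * (r - s)) * (n * 1)) r :=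
        HasDerivAt.comp (h₂ := Real.smoothTransition) r
          ((Real.smoothTransition.contDiff (n := 1)).differentiable one_ne_zero _).hasDerivAt
          (((hasDerivAt_id r).sub_const s).const_mul (n : ℝ))
      rw [h1.deriv, mul_one, abs_mul, Nat.abs_cast]
      exact mul_le_mul_of_nonneg_right (hC _) (Nat.cast_nonneg n)
    refine le_of_tendsto (tendsto_integral_of_dominated_convergence
      (F := fun n x => (u x - f x) * ψ n (u x)) (fun x => |u x - f x|)
      (fun n => (hu.sub hf).aestronglyMeasurable.mul
        ((hψc n).continuous.comp_aestronglyMeasurable hu.aestronglyMeasurable))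
      (hu.sub hf).abs (fun n => Eventually.of_forall fun x => ?_)
      (Eventually.of_forall fun x => ?_)) (Eventually.of_forall hle)
    · rw [Real.norm_eq_abs, abs_mul]
      exact mul_le_of_le_one_right (abs_nonneg _) (hψ1 n _)
    · refine tendsto_const_nhds.mul ?_
      by_cases hx : s < u x
      · obtain ⟨N, hN⟩ := exists_nat_gt (u x - s)⁻¹
        refine tendsto_const_nhds.congr' ?_
        filter_upwards [eventually_ge_atTop N] with n hn
        have hpos : 0 < u x - s := sub_pos.2 hx
        have h2 : (u x - s)⁻¹ ≤ n := hN.le.trans (Nat.cast_le.2 hn)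
        rw [inv_le_iff_one_le_mul₀ hpos] at h2
        simp only [χ, if_pos hx]
        exact (Real.smoothTransition.one_of_one_le h2).symm
      · refine tendsto_const_nhds.congr fun n => ?_
        simp only [χ, if_neg hx]
        exact (Real.smoothTransition.zero_of_nonpos
          (mul_nonpos_of_nonneg_of_nonpos (Nat.cast_nonneg n) (by linarith))).symm
  have e1 : ∫ x, (u x - f x) * χ (u x) ∂ν + ∫ x, (f x - s) * χ (u x) ∂ν =
      ∫ x, max (u x - s) 0 ∂ν := by
    have i1 : Integrable (fun x => u x - f x) ν := hu.sub hf
    have i2 : Integrable (fun x => f x - s) ν := hf.sub (integrable_const s)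
    rw [← integral_add (hint _ i1) (hint _ i2)]
    congr 1
    ext x
    by_cases hx : s < u x
    · simp only [χ, if_pos hx, max_eq_left (sub_pos.2 hx).le]; ring
    · simp only [χ, if_neg hx, max_eq_right (sub_nonpos.2 (not_lt.1 hx))]; ring
  have e2 : ∫ x, (f x - s) * χ (u x) ∂ν ≤ ∫ x, max (f x - s) 0 ∂ν := by
    refine integral_mono (hint _ (hf.sub (integrable_const s))) (integrable_posPart_sub hf s)
      fun x => ?_
    by_cases hx : s < u x
    · simp [χ, if_pos hx]
    · simp [χ, if_neg hx]
  linarith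

theorem Majorized.ae_le [IsFiniteMeasure ν] {f g : α → ℝ} (h : Majorized ν f g)
    (hf : Integrable f ν) {M : ℝ} (hg : ∀ᵐ x ∂ν, g x ≤ M) : ∀ᵐ x ∂ν, f x ≤ M := by
  have h1 : ∫ x, max (g x - M) 0 ∂ν = 0 := by
    rw [integral_eq_zero_of_ae]
    filter_upwards [hg] with x hx
    simpa using hx
  have h2 : ∫ x, max (f x - M) 0 ∂ν = 0 :=
    le_antisymm ((h M).trans h1.le) (integral_nonneg fun x => le_max_right _ _)
  filter_upwards [(integral_eq_zero_iff_of_nonneg (f := fun x => max (f x - M) 0)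
    (fun x => le_max_right _ _) (integrable_posPart_sub hf M)).1 h2] with x hx
  simpa using hx

/-- Layer-cake formula: powers with exponent p > 1 are mixtures of the functions (a - s)⁺. The
exponent p - 2 may be negative but exceeds -1, so the weight is integrable at 0. -/
theorem lintegral_posPart_sub_mul_rpow {p a : ℝ} (hp : 1 < p) (ha : 0 ≤ a) :
    ∫⁻ s in Set.Ioi (0 : ℝ), ENNReal.ofReal (max (a - s) 0) * ENNReal.ofReal (s ^ (p - 2)) =
      ENNReal.ofReal (p * (p - 1))⁻¹ * ENNReal.ofReal (a ^ p) := by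
  have hsplit : Set.Ioi (0 : ℝ) = Set.Ioc 0 a ∪ Set.Ioi a := (Set.Ioc_union_Ioi_eq_Ioi ha).symm
  have hzero : ∫⁻ s in Set.Ioi a,
      ENNReal.ofReal (max (a - s) 0) * ENNReal.ofReal (s ^ (p - 2)) = 0 := by
    rw [setLIntegral_congr_fun (g := fun _ => 0) measurableSet_Ioi]
    · simp
    · intro s hs
      simp [(Set.mem_Ioi.1 hs).le]
  have hint : IntervalIntegrable (fun s : ℝ => a * s ^ (p - 2) - s ^ (p - 1)) volume 0 a :=
    ((intervalIntegral.intervalIntegrable_rpow' (by linarith)).const_mul a).sub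
      (intervalIntegral.intervalIntegrable_rpow' (by linarith))
  have hmain : ∫⁻ s in Set.Ioc 0 a,
      ENNReal.ofReal (max (a - s) 0) * ENNReal.ofReal (s ^ (p - 2)) =
      ENNReal.ofReal (∫ s in (0 : ℝ)..a, (a * s ^ (p - 2) - s ^ (p - 1))) := by
    rw [intervalIntegral.integral_of_le ha, ofReal_integral_eq_lintegral_ofReal
      ((intervalIntegrable_iff_integrableOn_Ioc_of_le ha).1 hint)]
    · refine setLIntegral_congr_fun measurableSet_Ioc fun s hs => ?_
      have h1 : s ^ (p - 1) = s * s ^ (p - 2) := by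
        rw [show p - 1 = 1 + (p - 2) by ring, Real.rpow_add hs.1, Real.rpow_one]
      rw [max_eq_left (sub_nonneg.2 hs.2), ← ENNReal.ofReal_mul (sub_nonneg.2 hs.2), h1, sub_mul]
    · filter_upwards [ae_restrict_mem measurableSet_Ioc] with s hs
      have h1 : s ^ (p - 1) = s * s ^ (p - 2) := by
        rw [show p - 1 = 1 + (p - 2) by ring, Real.rpow_add hs.1, Real.rpow_one]
      rw [h1, ← sub_mul]
      exact mul_nonneg (sub_nonneg.2 hs.2) (Real.rpow_nonneg hs.1.le _)
  rw [hsplit, lintegral_union measurableSet_Ioi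
    (Set.disjoint_left.2 fun s hs hs' => (not_lt.2 hs.2) hs'), hzero, add_zero, hmain,
    intervalIntegral.integral_sub
      ((intervalIntegral.intervalIntegrable_rpow' (by linarith)).const_mul a)
      (intervalIntegral.intervalIntegrable_rpow' (by linarith)),
    intervalIntegral.integral_const_mul, integral_rpow (Or.inl (by linarith)),
    integral_rpow (Or.inl (by linarith)), ← ENNReal.ofReal_mul (by
      have : 0 < p * (p - 1) := mul_pos (by linarith) (by linarith)
      positivity)]
  congr 1
  rw [Real.zero_rpow (by linarith), Real.zero_rpow (by linarith)]
  have h2 : a * a ^ (p - 2 + 1) = a ^ p := by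
    rcases ha.eq_or_lt with rfl | ha
    · rw [zero_mul, Real.zero_rpow (by linarith)]
    · nth_rewrite 1 [← Real.rpow_one a]
      rw [← Real.rpow_add ha]
      congr 1
      ring
  rw [sub_zero, sub_zero, mul_div_assoc', h2, show p - 1 + 1 = p by ring]
  have : p - 1 ≠ 0 := by linarith
  have : p ≠ 0 := by linarith
  rw [show p - 2 + 1 = p - 1 by ring]
  field_simp
  ring

theorem lintegral_rpow_eq_lintegral_posPart [IsFiniteMeasure ν] {f : α → ℝ}
    (hf : AEMeasurable f ν) {p : ℝ} (hp : 1 < p) :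
    ENNReal.ofReal (p * (p - 1))⁻¹ * ∫⁻ x, ENNReal.ofReal (|f x| ^ p) ∂ν =
      ∫⁻ s in Set.Ioi (0 : ℝ), (∫⁻ x, ENNReal.ofReal (max (|f x| - s) 0) ∂ν) *
        ENNReal.ofReal (s ^ (p - 2)) := by
  rw [← lintegral_const_mul' _ _ ENNReal.ofReal_ne_top]
  simp_rw [← lintegral_posPart_sub_mul_rpow hp (abs_nonneg _)]
  rw [lintegral_lintegral_swap]
  · refine lintegral_congr fun s => ?_
    rw [lintegral_mul_const' _ _ ENNReal.ofReal_ne_top]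
  · have h1 : AEMeasurable (fun z : α × ℝ => f z.1) (ν.prod (volume.restrict (Set.Ioi 0))) :=
      hf.comp_fst
    have h2 : Measurable fun s : ℝ => s ^ (p - 2) := measurable_id.pow_const _
    exact ((((continuous_abs.measurable.comp_aemeasurable h1).sub
      measurable_snd.aemeasurable).max aemeasurable_const).ennreal_ofReal).mul
        (h2.comp measurable_snd).ennreal_ofReal.aemeasurable

theorem Majorized.eLpNorm_le [IsFiniteMeasure ν] {f g : α → ℝ} (h : Majorized ν f g)
    (h' : Majorized ν (fun x => -f x) fun x => -g x) (hf : Integrable f ν) (hg : Integrable g ν)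
    {p : ℝ≥0∞} (hp : 1 < p) (hp' : p < ∞) : eLpNorm f p ν ≤ eLpNorm g p ν := by
  have hpr : 1 < p.toReal := by
    rw [← ENNReal.toReal_one]
    exact (ENNReal.toReal_lt_toReal ENNReal.one_ne_top hp'.ne).2 hp
  have hpos : ∀ s : ℝ, s ∈ Set.Ioi (0 : ℝ) →
      ∫⁻ x, ENNReal.ofReal (max (|f x| - s) 0) ∂ν ≤
        ∫⁻ x, ENNReal.ofReal (max (|g x| - s) 0) ∂ν := by
    intro s hs
    -- For s > 0 at most one of the two positive parts is nonzero; this is where the majorizations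
    -- of both f and -f enter.
    have e : ∀ r : ℝ, max (|r| - s) 0 = max (r - s) 0 + max (-r - s) 0 := by
      intro r
      have hs' : 0 < s := hs
      rcases le_total 0 r with hr | hr
      · rw [abs_of_nonneg hr, max_eq_right (a := -r - s) (by linarith), add_zero]
      · rw [abs_of_nonpos hr, max_eq_right (a := r - s) (by linarith), zero_add]
    rw [← ofReal_integral_eq_lintegral_ofReal (integrable_posPart_sub hf.abs s)
      (Eventually.of_forall fun x => le_max_right _ _),
      ← ofReal_integral_eq_lintegral_ofReal (integrable_posPart_sub hg.abs s)
      (Eventually.of_forall fun x => le_max_right _ _)]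
    refine ENNReal.ofReal_le_ofReal ?_
    have nf : Integrable (fun x => -f x) ν := hf.neg
    have ng : Integrable (fun x => -g x) ν := hg.neg
    simp_rw [e]
    rw [integral_add (integrable_posPart_sub hf s) (integrable_posPart_sub nf s),
      integral_add (integrable_posPart_sub hg s) (integrable_posPart_sub ng s)]
    exact add_le_add (h s) (h' s)
  have hc : ENNReal.ofReal (p.toReal * (p.toReal - 1))⁻¹ ≠ 0 := by
    rw [Ne, ENNReal.ofReal_eq_zero, not_le]
    have : 0 < p.toReal * (p.toReal - 1) := mul_pos (by linarith) (by linarith)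
    positivity
  have hle : ∫⁻ x, ENNReal.ofReal (|f x| ^ p.toReal) ∂ν ≤
      ∫⁻ x, ENNReal.ofReal (|g x| ^ p.toReal) ∂ν := by
    rw [← ENNReal.mul_le_mul_iff_right hc ENNReal.ofReal_ne_top,
      lintegral_rpow_eq_lintegral_posPart hf.aemeasurable hpr,
      lintegral_rpow_eq_lintegral_posPart hg.aemeasurable hpr]
    refine setLIntegral_mono' measurableSet_Ioi fun s hs => ?_
    exact mul_le_mul_left (hpos s hs) _
  have e : ∀ r : ℝ, ‖r‖ₑ ^ p.toReal = ENNReal.ofReal (|r| ^ p.toReal) := fun r => by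
    rw [Real.enorm_eq_ofReal_abs, ENNReal.ofReal_rpow_of_nonneg (abs_nonneg _) (by linarith)]
  rw [eLpNorm_eq_lintegral_rpow_enorm_toReal (by positivity) hp'.ne,
    eLpNorm_eq_lintegral_rpow_enorm_toReal (by positivity) hp'.ne]
  simp_rw [e]
  gcongr

end Majorization

end WeightedOU

namespace WeightedOU

/-! ### Extension of Markov semigroups from `L²` to `L^p` -/

section Inclusion

variable {α : Type*} [MeasurableSpace α] (ν : Measure α) [IsFiniteMeasure ν]

/-- The inclusion of `L^q` in `L^p` for a finite measure and `p ≤ q`. -/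
noncomputable def lpIncl {p q : ℝ≥0∞} [Fact (1 ≤ p)] [Fact (1 ≤ q)] (h : p ≤ q) :
    Lp ℝ q ν →L[ℝ] Lp ℝ p ν :=
  LinearMap.mkContinuous
    { toFun := fun f => ((Lp.memLp f).mono_exponent h).toLp f
      map_add' := fun f g => by
        rw [← MemLp.toLp_add]
        exact MemLp.toLp_congr _ _ (Lp.coeFn_add f g)
      map_smul' := fun c f => by
        rw [RingHom.id_apply, ← MemLp.toLp_const_smul]
        exact MemLp.toLp_congr _ _ (Lp.coeFn_smul c f) }
    (ν Set.univ ^ (1 / p.toReal - 1 / q.toReal)).toReal fun f => by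
      change ‖((Lp.memLp f).mono_exponent h).toLp f‖ ≤ _
      rw [Lp.norm_toLp, Lp.norm_def, mul_comm, ← ENNReal.toReal_mul]
      have hfin : ν Set.univ ^ (1 / p.toReal - 1 / q.toReal) ≠ ∞ := by
        rcases eq_or_ne q ∞ with rfl | hq
        · simp only [ENNReal.toReal_top, div_zero, sub_zero]
          exact ENNReal.rpow_ne_top_of_nonneg (by positivity) (measure_ne_top ν _)
        · refine ENNReal.rpow_ne_top_of_nonneg ?_ (measure_ne_top ν _)
          have hp1 : (1 : ℝ≥0∞) ≤ p := Fact.out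
          have hp : 0 < p.toReal := ENNReal.toReal_pos (by positivity) (h.trans_lt hq.lt_top).ne
          exact sub_nonneg.2 (one_div_le_one_div_of_le hp (ENNReal.toReal_mono hq h))
      exact ENNReal.toReal_mono (ENNReal.mul_ne_top (Lp.eLpNorm_ne_top f) hfin)
        (eLpNorm_le_eLpNorm_mul_rpow_measure_univ h (Lp.aestronglyMeasurable f))

variable {ν}

theorem coeFn_lpIncl {p q : ℝ≥0∞} [Fact (1 ≤ p)] [Fact (1 ≤ q)] (h : p ≤ q) (f : Lp ℝ q ν) :
    lpIncl ν h f =ᵐ[ν] f :=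
  MemLp.coeFn_toLp ((Lp.memLp f).mono_exponent h)

theorem denseRange_lpIncl {p q : ℝ≥0∞} [Fact (1 ≤ p)] [Fact (1 ≤ q)] (h : p ≤ q) (hp : p ≠ ∞) :
    DenseRange (lpIncl ν h) := by
  refine Dense.mono ?_ (Lp.simpleFunc.dense (E := ℝ) (μ := ν) hp)
  intro f hf
  let g : Lp.simpleFunc ℝ p ν := ⟨f, hf⟩
  refine ⟨((Lp.simpleFunc.toSimpleFunc g).memLp_of_isFiniteMeasure q ν).toLp _, Lp.ext ?_⟩
  exact (coeFn_lpIncl h _).trans ((MemLp.coeFn_toLp _).trans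
    (Lp.simpleFunc.toSimpleFunc_eq_toFun g))

omit [IsFiniteMeasure ν] in
theorem ae_abs_le_norm (f : Lp ℝ ∞ ν) : ∀ᵐ x ∂ν, |f x| ≤ ‖f‖ := by
  filter_upwards [ae_le_eLpNormEssSup (f := f) (μ := ν)] with x hx
  rw [← eLpNorm_exponent_top] at hx
  rw [Lp.norm_def, ← Real.norm_eq_abs, ← toReal_enorm]
  exact ENNReal.toReal_mono (Lp.eLpNorm_ne_top f) hx

theorem integrable_coeFn {p : ℝ≥0∞} [Fact (1 ≤ p)] (f : Lp ℝ p ν) : Integrable f ν :=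
  (Lp.memLp f).integrable Fact.out

end Inclusion

/-- A bounded intertwiner carries difference quotients to difference quotients; this is the source
of the inclusions between generator domains. -/
theorem C0Semigroup.map_mem_generator {E E' : Type*} [NormedAddCommGroup E] [NormedSpace ℝ E]
    [NormedAddCommGroup E'] [NormedSpace ℝ E'] {S : C0Semigroup E} {S' : C0Semigroup E'}
    (j : E →L[ℝ] E') (h : ∀ t x, j (S.toFun t x) = S'.toFun t (j x)) {z : E × E}
    (hz : z ∈ S.generator) : (j z.1, j z.2) ∈ S'.generator := by
  have h1 : Tendsto (fun t : ℝ≥0 => (t : ℝ)⁻¹ • (S.toFun t z.1 - z.1)) (𝓝[>] 0) (𝓝 z.2) := hz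
  refine ((j.continuous.tendsto _).comp h1).congr fun t => ?_
  simp only [Function.comp_apply, map_smul, map_sub, h]

theorem C0Semigroup.ext_of_forall {E : Type*} [NormedAddCommGroup E] [NormedSpace ℝ E]
    {S S' : C0Semigroup E} (h : ∀ t, S.toFun t = S'.toFun t) : S = S' := by
  cases S
  cases S'
  congr
  exact funext h

/-! ### Majorizing operators and consistent semigroups on the L^p scale -/

section Extension

variable {α : Type*} [MeasurableSpace α] {ν : Measure α}

/-- A bounded operator on `L²` all of whose values are majorized by the argument. -/
def IsMajorizing (T : Lp ℝ 2 ν →L[ℝ] Lp ℝ 2 ν) : Prop :=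
  ∀ f, Majorized ν (T f) f

variable [IsFiniteMeasure ν]

omit [IsFiniteMeasure ν] in
theorem IsMajorizing.neg {T : Lp ℝ 2 ν →L[ℝ] Lp ℝ 2 ν} (hT : IsMajorizing T) (f : Lp ℝ 2 ν) :
    Majorized ν (fun x => -T f x) fun x => -f x := by
  intro s
  have h := hT (-f) s
  rw [map_neg] at h
  have h1 : ∫ x, max ((-T f : Lp ℝ 2 ν) x - s) 0 ∂ν = ∫ x, max (-T f x - s) 0 ∂ν :=
    integral_congr_ae (by filter_upwards [Lp.coeFn_neg (T f)] with x hx; rw [hx, Pi.neg_apply])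
  have h2 : ∫ x, max ((-f : Lp ℝ 2 ν) x - s) 0 ∂ν = ∫ x, max (-f x - s) 0 ∂ν :=
    integral_congr_ae (by filter_upwards [Lp.coeFn_neg f] with x hx; rw [hx, Pi.neg_apply])
  rwa [h1, h2] at h

theorem IsMajorizing.eLpNorm_le {T : Lp ℝ 2 ν →L[ℝ] Lp ℝ 2 ν} (hT : IsMajorizing T)
    {p : ℝ≥0∞} (hp : 1 < p) (hp' : p < ∞) (f : Lp ℝ 2 ν) :
    eLpNorm (T f) p ν ≤ eLpNorm f p ν :=
  (hT f).eLpNorm_le (hT.neg f) (integrable_coeFn _) (integrable_coeFn _) hp hp'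

theorem IsMajorizing.ae_abs_le {T : Lp ℝ 2 ν →L[ℝ] Lp ℝ 2 ν} (hT : IsMajorizing T)
    {f : Lp ℝ 2 ν} {M : ℝ} (hf : ∀ᵐ x ∂ν, |f x| ≤ M) : ∀ᵐ x ∂ν, |T f x| ≤ M := by
  filter_upwards [(hT f).ae_le (integrable_coeFn _) (hf.mono fun x hx => (abs_le.1 hx).2),
    (hT.neg f).ae_le (integrable_coeFn _).neg (M := M)
      (hf.mono fun x hx => by linarith [(abs_le.1 hx).1])] with x h1 h2
  exact abs_le.2 ⟨by linarith, h1⟩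

theorem IsMajorizing.nonneg {T : Lp ℝ 2 ν →L[ℝ] Lp ℝ 2 ν} (hT : IsMajorizing T)
    {f : Lp ℝ 2 ν} (hf : 0 ≤ᵐ[ν] f) : 0 ≤ᵐ[ν] T f := by
  filter_upwards [(hT.neg f).ae_le (integrable_coeFn _).neg (M := 0)
      (hf.mono fun x hx => by simpa using hx)] with x hx
  simpa using hx

/-- On bounded functions the operator is already an L^p contraction, and these are dense in L^p.
Agreement on all of L² ∩ L^p needs a further density argument in a space contained in both. -/
theorem IsMajorizing.exists_lpExtension {T : Lp ℝ 2 ν →L[ℝ] Lp ℝ 2 ν} (hT : IsMajorizing T)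
    {p : ℝ≥0∞} [Fact (1 ≤ p)] (hp : 1 < p) (hp' : p < ∞) :
    ∃ T' : Lp ℝ p ν →L[ℝ] Lp ℝ p ν, ‖T'‖ ≤ 1 ∧
      ∀ (f : Lp ℝ 2 ν) (g : Lp ℝ p ν), f =ᵐ[ν] g → T f =ᵐ[ν] T' g := by
  have hmem : ∀ f : Lp ℝ ∞ ν, MemLp (T (lpIncl ν le_top f)) p ν := fun f =>
    ⟨Lp.aestronglyMeasurable _, (hT.eLpNorm_le hp hp' _).trans_lt
      ((Lp.memLp f).ae_eq (coeFn_lpIncl _ f).symm |>.mono_exponent le_top).2⟩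
  let R : Lp ℝ ∞ ν →ₗ[ℝ] Lp ℝ p ν :=
    { toFun := fun f => (hmem f).toLp _
      map_add' := fun f g => by
        rw [← MemLp.toLp_add]
        refine MemLp.toLp_congr _ _ ?_
        rw [map_add, map_add]
        exact Lp.coeFn_add _ _
      map_smul' := fun c f => by
        rw [RingHom.id_apply, ← MemLp.toLp_const_smul]
        refine MemLp.toLp_congr _ _ ?_
        rw [map_smul, map_smul]
        exact Lp.coeFn_smul _ _ }
  have hR : ∀ f, R f =ᵐ[ν] T (lpIncl ν le_top f) := fun f => MemLp.coeFn_toLp (hmem f)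
  let e : Lp ℝ ∞ ν →ₗ[ℝ] Lp ℝ p ν := (lpIncl ν le_top).toLinearMap
  have he : DenseRange e := denseRange_lpIncl le_top hp'.ne
  have hbound : ∀ f, ‖R f‖ ≤ 1 * ‖e f‖ := by
    intro f
    rw [one_mul, Lp.norm_def, Lp.norm_def]
    refine ENNReal.toReal_mono (Lp.eLpNorm_ne_top _) ?_
    rw [eLpNorm_congr_ae (hR f)]
    refine (hT.eLpNorm_le hp hp' _).trans_eq (eLpNorm_congr_ae ?_)
    exact (coeFn_lpIncl _ f).trans (coeFn_lpIncl _ f).symm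
  refine ⟨R.extendOfNorm e, LinearMap.opNorm_extendOfNorm_le he zero_le_one hbound, ?_⟩
  intro f g hfg
  -- For a finite measure L² ∩ L^p = L^r. Bounded functions are dense in L^r, and both candidate
  -- values depend continuously on the L^r argument once compared in L¹.
  let r : ℝ≥0∞ := max 2 p
  have : Fact (1 ≤ r) := ⟨(Fact.out : (1 : ℝ≥0∞) ≤ p).trans (le_max_right _ _)⟩
  have hr : r ≠ ∞ := (max_lt ENNReal.ofNat_lt_top hp').ne
  have hg : MemLp g r ν := by
    rcases le_total 2 p with h | h
    · rw [show r = p from max_eq_right h]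
      exact Lp.memLp g
    · rw [show r = 2 from max_eq_left h]
      exact (Lp.memLp f).ae_eq hfg
  have key : (fun k : Lp ℝ r ν => lpIncl ν (p := 1) (by norm_num) (T (lpIncl ν (le_max_left 2 p) k)))
      = fun k => lpIncl ν (p := 1) hp.le (R.extendOfNorm e (lpIncl ν (le_max_right 2 p) k)) := by
    refine (denseRange_lpIncl (ν := ν) (q := ∞) (p := r) le_top hr).equalizer
      (by fun_prop) (by fun_prop) (funext fun k => ?_)
    have h1 : lpIncl ν (le_max_left 2 p) (lpIncl ν (p := r) le_top k) = lpIncl ν le_top k :=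
      Lp.ext ((coeFn_lpIncl _ _).trans ((coeFn_lpIncl _ _).trans (coeFn_lpIncl _ _).symm))
    have h2 : lpIncl ν (le_max_right 2 p) (lpIncl ν (p := r) le_top k) = e k :=
      Lp.ext ((coeFn_lpIncl _ _).trans ((coeFn_lpIncl _ _).trans (coeFn_lpIncl _ _).symm))
    simp only [Function.comp_apply]
    rw [h1, h2, LinearMap.extendOfNorm_eq he ⟨1, hbound⟩]
    exact Lp.ext ((coeFn_lpIncl _ _).trans ((hR k).symm.trans (coeFn_lpIncl _ _).symm))
  have h1 : lpIncl ν (le_max_left 2 p) (hg.toLp g) = f :=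
    Lp.ext ((coeFn_lpIncl _ _).trans ((MemLp.coeFn_toLp _).trans hfg.symm))
  have h2 : lpIncl ν (le_max_right 2 p) (hg.toLp g) = g :=
    Lp.ext ((coeFn_lpIncl _ _).trans (MemLp.coeFn_toLp _))
  have h3 := congrFun key (hg.toLp g)
  rw [h1, h2] at h3
  refine (coeFn_lpIncl (p := 1) (by norm_num) (T f)).symm.trans ?_
  rw [h3]
  exact coeFn_lpIncl _ _

omit [IsFiniteMeasure ν] in
-- From |f|^p ≤ K^{p-2} |f|²: on bounded sets of L^∞, convergence in L² implies convergence in L^p.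
theorem eLpNorm_le_of_ae_abs_le {f : α → ℝ} {K : ℝ} (hf : ∀ᵐ x ∂ν, |f x| ≤ K) {p : ℝ≥0∞}
    (hp : 2 ≤ p) (hp' : p < ∞) :
    eLpNorm f p ν ≤ (ENNReal.ofReal K ^ (p.toReal - 2)) ^ (1 / p.toReal) *
      eLpNorm f 2 ν ^ (2 / p.toReal) := by
  have hpr : 2 ≤ p.toReal := by
    rw [← ENNReal.toReal_ofNat]
    exact ENNReal.toReal_mono hp'.ne hp
  rw [eLpNorm_eq_lintegral_rpow_enorm_toReal (by positivity) hp'.ne,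
    eLpNorm_eq_lintegral_rpow_enorm_toReal (by norm_num) (by norm_num),
    ← ENNReal.rpow_mul (∫⁻ x, ‖f x‖ₑ ^ (2 : ℝ≥0∞).toReal ∂ν),
    show 1 / (2 : ℝ≥0∞).toReal * (2 / p.toReal) = 1 / p.toReal by rw [ENNReal.toReal_ofNat]; ring,
    ← ENNReal.mul_rpow_of_nonneg _ _ (by positivity)]
  refine ENNReal.rpow_le_rpow ?_ (by positivity)
  rw [← lintegral_const_mul' _ _ (ENNReal.rpow_ne_top_of_nonneg (by linarith)
    ENNReal.ofReal_ne_top)]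
  refine lintegral_mono_ae ?_
  filter_upwards [hf] with x hx
  rw [show p.toReal = (p.toReal - 2) + (2 : ℝ≥0∞).toReal by simp,
    ENNReal.rpow_add_of_nonneg _ _ (by linarith) (by simp), ENNReal.toReal_ofNat,
    add_sub_cancel_right]
  gcongr
  rw [Real.enorm_eq_ofReal_abs]
  exact ENNReal.ofReal_le_ofReal hx

theorem IsLpExtension.lpIncl_apply {T₂ : C0Semigroup (Lp ℝ 2 ν)} {p q : ℝ≥0∞} [Fact (1 ≤ p)]
    [Fact (1 ≤ q)] (hpq : p ≤ q) (hq : q ≠ ∞) {Tp : C0Semigroup (Lp ℝ p ν)}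
    {Tq : C0Semigroup (Lp ℝ q ν)} (hTp : IsLpExtension T₂ p Tp) (hTq : IsLpExtension T₂ q Tq)
    (t : ℝ≥0) (f : Lp ℝ q ν) :
    lpIncl ν hpq (Tq.toFun t f) = Tp.toFun t (lpIncl ν hpq f) := by
  have h : (fun f => lpIncl ν hpq (Tq.toFun t f)) = fun f => Tp.toFun t (lpIncl ν hpq f) := by
    refine (denseRange_lpIncl (ν := ν) (q := ∞) (p := q) le_top hq).equalizer
      (by fun_prop) (by fun_prop) (funext fun k => Lp.ext ?_)
    have h1 := hTp.consistent t (lpIncl ν le_top k) (lpIncl ν hpq (lpIncl ν le_top k))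
      ((coeFn_lpIncl _ _).trans ((coeFn_lpIncl _ _).trans (coeFn_lpIncl _ _)).symm)
    have h2 := hTq.consistent t (lpIncl ν le_top k) (lpIncl ν le_top k)
      ((coeFn_lpIncl _ _).trans (coeFn_lpIncl _ _).symm)
    exact (coeFn_lpIncl _ _).trans (h2.symm.trans h1)
  exact congrFun h f

theorem IsLpExtension.unique {T₂ : C0Semigroup (Lp ℝ 2 ν)} {p : ℝ≥0∞} [Fact (1 ≤ p)]
    (hp : p ≠ ∞) {T T' : C0Semigroup (Lp ℝ p ν)} (hT : IsLpExtension T₂ p T)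
    (hT' : IsLpExtension T₂ p T') : T = T' := by
  have hid : ∀ f : Lp ℝ p ν, lpIncl ν le_rfl f = f := fun f => Lp.ext (coeFn_lpIncl _ _)
  refine C0Semigroup.ext_of_forall fun t => ContinuousLinearMap.ext fun f => ?_
  have := hT'.lpIncl_apply le_rfl hp hT t f
  rwa [hid, hid] at this

/-- Every property is checked on bounded functions and extended by density. Strong continuity comes
from that of T_2: through L² ⊂ L^p if p ≤ 2, through the uniform L^∞ bound on the orbit if p ≥ 2. -/
theorem exists_isLpExtension {T₂ : C0Semigroup (Lp ℝ 2 ν)}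
    (hT : ∀ t, IsMajorizing (T₂.toFun t)) {p : ℝ≥0∞} [Fact (1 ≤ p)] (hp : 1 < p) (hp' : p < ∞) :
    ∃ T : C0Semigroup (Lp ℝ p ν), IsLpExtension T₂ p T := by
  choose T hT1 hTc using fun t => (hT t).exists_lpExtension hp hp'
  have hle : ∀ t f, ‖T t f‖ ≤ ‖f‖ := fun t f => by
    simpa using (T t).le_of_opNorm_le (hT1 t) f
  have hd := denseRange_lpIncl (ν := ν) (q := ∞) (p := p) le_top hp'.ne
  have hincl : ∀ k : Lp ℝ ∞ ν,
      (lpIncl ν le_top k : Lp ℝ 2 ν) =ᵐ[ν] (lpIncl ν le_top k : Lp ℝ p ν) := fun k =>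
    (coeFn_lpIncl _ _).trans (coeFn_lpIncl _ _).symm
  have hcont : ∀ f, Continuous fun t => T t f := by
    refine fun f => closure_minimal (s := Set.range (lpIncl ν le_top)) ?_
      (isClosed_setOf_continuous_orbit hle) (hd f)
    rintro _ ⟨k, rfl⟩
    have hc2 := T₂.continuous_orbit (lpIncl ν le_top k)
    rcases le_total p 2 with h | h
    · have e : ∀ t, T t (lpIncl ν le_top k) = lpIncl ν h (T₂.toFun t (lpIncl ν le_top k)) :=
        fun t => Lp.ext ((hTc t _ _ (hincl k)).symm.trans (coeFn_lpIncl _ _).symm)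
      change Continuous fun t => T t (lpIncl ν le_top k)
      simp_rw [e]
      exact (lpIncl ν h).continuous.comp hc2
    · change Continuous fun t => T t (lpIncl ν le_top k)
      rw [continuous_iff_continuousAt]
      intro t₀
      have hM : ∀ t, ∀ᵐ x ∂ν, |T₂.toFun t (lpIncl ν le_top k) x| ≤ ‖k‖ := fun t =>
        (hT t).ae_abs_le (by
          filter_upwards [coeFn_lpIncl (p := 2) le_top k, ae_abs_le_norm k] with x h1 h2
          rwa [h1])
      rw [ContinuousAt, Lp.tendsto_Lp_iff_tendsto_eLpNorm']
      have h2 := (hc2.tendsto t₀)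
      rw [Lp.tendsto_Lp_iff_tendsto_eLpNorm'] at h2
      have hpr : 0 < p.toReal := ENNReal.toReal_pos (by positivity) hp'.ne
      have hpr2 : 2 ≤ p.toReal := by
        rw [← ENNReal.toReal_ofNat]
        exact ENNReal.toReal_mono hp'.ne h
      -- Two orbit points, each bounded by `‖k‖`, differ by at most `2 * ‖k‖`.
      have h3 := ENNReal.Tendsto.const_mul
        (a := (ENNReal.ofReal (2 * ‖k‖) ^ (p.toReal - 2)) ^ (1 / p.toReal))
        (h2.ennrpow_const (2 / p.toReal)) (Or.inr (by
          refine ENNReal.rpow_ne_top_of_nonneg (by positivity)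
            (ENNReal.rpow_ne_top_of_nonneg (by linarith) ENNReal.ofReal_ne_top)))
      rw [ENNReal.zero_rpow_of_pos (by positivity), mul_zero] at h3
      refine tendsto_of_tendsto_of_tendsto_of_le_of_le tendsto_const_nhds h3
        (fun _ => zero_le) fun t => ?_
      have e : ⇑(T t (lpIncl ν le_top k)) - ⇑(T t₀ (lpIncl ν le_top k)) =ᵐ[ν]
          ⇑(T₂.toFun t (lpIncl ν le_top k)) - ⇑(T₂.toFun t₀ (lpIncl ν le_top k)) :=
        (hTc t _ _ (hincl k)).symm.sub (hTc t₀ _ _ (hincl k)).symm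
      dsimp only
      rw [eLpNorm_congr_ae e]
      refine eLpNorm_le_of_ae_abs_le ?_ h hp'
      filter_upwards [hM t, hM t₀] with x h4 h5
      rw [Pi.sub_apply, two_mul]
      exact (abs_sub _ _).trans (add_le_add h4 h5)
  refine ⟨⟨T, ?_, fun s t => ?_, hcont⟩, hT1, fun t f hf => ?_, hTc⟩
  · refine ContinuousLinearMap.ext fun f => congrFun (hd.equalizer (T 0).continuous
      (ContinuousLinearMap.id ℝ _).continuous (funext fun k => Lp.ext ?_)) f
    have h := hTc 0 _ _ (hincl k)
    rw [T₂.map_zero] at h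
    exact h.symm.trans (hincl k)
  · refine ContinuousLinearMap.ext fun f => congrFun (hd.equalizer (T (s + t)).continuous
      ((T s).comp (T t)).continuous (funext fun k => Lp.ext ?_)) f
    have h := hTc (s + t) _ _ (hincl k)
    rw [T₂.map_add] at h
    exact h.symm.trans (hTc s _ _ (hTc t _ _ (hincl k)))
  -- Stated for g ⊔ 0, positivity is a closed condition on an arbitrary g, so density of bounded
  -- functions suffices without approximating inside the positive cone.
  · have hpos : ∀ g : Lp ℝ p ν, 0 ≤ T t (g ⊔ 0) := by
      intro g
      refine hd.induction_on (p := fun g => 0 ≤ T t (g ⊔ 0)) g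
        (isClosed_le continuous_const (by fun_prop)) fun k => ?_
      rw [← Lp.coeFn_nonneg]
      have h1 : ((lpIncl ν le_top k ⊔ 0 : Lp ℝ 2 ν) : α → ℝ) =ᵐ[ν]
          (lpIncl ν le_top k ⊔ 0 : Lp ℝ p ν) := by
        filter_upwards [Lp.coeFn_sup (lpIncl ν le_top k : Lp ℝ 2 ν) 0,
          Lp.coeFn_sup (lpIncl ν le_top k : Lp ℝ p ν) 0, hincl k, Lp.coeFn_zero ℝ 2 ν,
          Lp.coeFn_zero ℝ p ν] with x h1 h2 h3 h4 h5
        rw [h1, h2, Pi.sup_apply, Pi.sup_apply, h3, h4, h5]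
      have h2 : 0 ≤ᵐ[ν] (lpIncl ν le_top k ⊔ 0 : Lp ℝ 2 ν) :=
        (Lp.coeFn_nonneg _).2 le_sup_right
      filter_upwards [(hT t).nonneg h2, hTc t _ _ h1] with x h3 h4
      rwa [← h4]
    have := hpos f
    rwa [sup_eq_left.2 hf] at this

end Extension

end WeightedOU

namespace WeightedOU

/-! ### The adjoint of the generator and the drift operator -/

section Drift

variable {X : Type*} [NormedAddCommGroup X] [NormedSpace ℝ X]

theorem C0Semigroup.IsContraction.norm_le {S : C0Semigroup X} (hS : S.IsContraction) (t : ℝ≥0)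
    (x : X) : ‖S.toFun t x‖ ≤ ‖x‖ := by
  simpa using (S.toFun t).le_of_opNorm_le (hS t) x

theorem C0Semigroup.continuous_orbit_toNNReal (S : C0Semigroup X) (x : X) :
    Continuous fun r : ℝ => S.toFun r.toNNReal x :=
  (S.continuous_orbit x).comp continuous_real_toNNReal

theorem C0Semigroup.IsContraction.continuous_apply {S : C0Semigroup X} (hS : S.IsContraction)
    {v : ℝ → X} (hv : Continuous v) : Continuous fun r : ℝ => S.toFun r.toNNReal (v r) := by
  rw [continuous_iff_continuousAt]
  intro s
  have h1 : Tendsto (fun r : ℝ => S.toFun r.toNNReal (v r - v s)) (𝓝 s) (𝓝 0) := by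
    refine squeeze_zero_norm (fun r => hS.norm_le _ _) ?_
    have h : Continuous fun r => ‖v r - v s‖ := by fun_prop
    simpa using h.tendsto s
  have h2 := h1.add ((S.continuous_orbit_toNNReal (v s)).tendsto s)
  rw [zero_add] at h2
  refine h2.congr fun r => ?_
  rw [map_sub, sub_add_cancel]

/-- The operator `x ↦ ∫₀ʰ S(s) x ds`. -/
noncomputable def C0Semigroup.orbitIntegral (S : C0Semigroup X) (hS : S.IsContraction) (h : ℝ) :
    X →L[ℝ] X :=
  LinearMap.mkContinuous
    { toFun := fun x => ∫ s in (0 : ℝ)..h, S.toFun s.toNNReal x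
      map_add' := fun x y => by
        rw [← intervalIntegral.integral_add
          ((S.continuous_orbit_toNNReal x).intervalIntegrable _ _)
          ((S.continuous_orbit_toNNReal y).intervalIntegrable _ _)]
        exact intervalIntegral.integral_congr fun s _ => (S.toFun _).map_add x y
      map_smul' := fun c x => by
        rw [RingHom.id_apply, ← intervalIntegral.integral_smul]
        exact intervalIntegral.integral_congr fun s _ => (S.toFun _).map_smul c x } |h|
    fun x => by
      change ‖∫ s in (0 : ℝ)..h, S.toFun s.toNNReal x‖ ≤ _
      refine (intervalIntegral.norm_integral_le_of_norm_le_const fun s _ =>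
        hS.norm_le _ _).trans_eq ?_
      rw [sub_zero, mul_comm]

theorem C0Semigroup.orbitIntegral_apply (S : C0Semigroup X) (hS : S.IsContraction) (h : ℝ)
    (x : X) : S.orbitIntegral hS h x = ∫ s in (0 : ℝ)..h, S.toFun s.toNNReal x :=
  rfl

theorem C0Semigroup.hasDerivAt_orbitIntegral [CompleteSpace X] (S : C0Semigroup X)
    (hS : S.IsContraction) (x : X) (h : ℝ) :
    HasDerivAt (fun h => S.orbitIntegral hS h x) (S.toFun h.toNNReal x) h :=
  ((S.continuous_orbit_toNNReal x).integral_hasStrictDerivAt 0 h).hasDerivAt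

theorem C0Semigroup.apply_orbitIntegral [CompleteSpace X] (S : C0Semigroup X)
    (hS : S.IsContraction) {h : ℝ} (hh : 0 ≤ h) (t : ℝ≥0) (x : X) :
    S.toFun t (S.orbitIntegral hS h x) =
      S.orbitIntegral hS (h + t) x - S.orbitIntegral hS (0 + t) x := by
  have hint := fun a b => (S.continuous_orbit_toNNReal x).intervalIntegrable (μ := volume) a b
  rw [orbitIntegral_apply, ← ContinuousLinearMap.intervalIntegral_comp_comm _ (hint _ _),
    orbitIntegral_apply, orbitIntegral_apply,
    intervalIntegral.integral_interval_sub_left (hint _ _) (hint _ _),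
    ← intervalIntegral.integral_comp_add_right]
  refine intervalIntegral.integral_congr fun s hs => ?_
  rw [Set.uIcc_of_le hh] at hs
  rw [Real.toNNReal_add hs.1 t.coe_nonneg, Real.toNNReal_coe, add_comm, S.map_add]
  rfl

theorem tendsto_coe_nhdsGT_zero : Tendsto (fun t : ℝ≥0 => (t : ℝ)) (𝓝[>] 0) (𝓝[>] 0) := by
  refine tendsto_nhdsWithin_iff.2 ⟨tendsto_nhdsWithin_of_tendsto_nhds ?_, ?_⟩
  · exact (NNReal.continuous_coe.tendsto 0)
  · filter_upwards [self_mem_nhdsWithin] with t ht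
    exact NNReal.coe_pos.2 ht

theorem C0Semigroup.orbitIntegral_mem_generator [CompleteSpace X] (S : C0Semigroup X)
    (hS : S.IsContraction) {h : ℝ} (hh : 0 ≤ h) (x : X) :
    (S.orbitIntegral hS h x, S.toFun h.toNNReal x - x) ∈ S.generator := by
  have h1 := (S.hasDerivAt_orbitIntegral hS x h).tendsto_slope_zero_right.comp
    tendsto_coe_nhdsGT_zero
  have h2 := (S.hasDerivAt_orbitIntegral hS x 0).tendsto_slope_zero_right.comp
    tendsto_coe_nhdsGT_zero
  have h3 := h1.sub h2
  rw [Real.toNNReal_zero, S.map_zero] at h3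
  refine h3.congr fun t => ?_
  simp only [Function.comp_apply]
  rw [S.apply_orbitIntegral hS hh, ← smul_sub]
  have h0 : S.orbitIntegral hS 0 x = 0 := by
    rw [orbitIntegral_apply, intervalIntegral.integral_same]
  rw [h0]
  congr 1
  abel

/-- The integral operator commutes with the semigroup, so it can be applied to the difference
quotients of w.1, whose limit is then known from `orbitIntegral_mem_generator`. -/
theorem C0Semigroup.orbitIntegral_apply_generator [CompleteSpace X] (S : C0Semigroup X)
    (hS : S.IsContraction) {h : ℝ} (hh : 0 ≤ h) {w : X × X} (hw : w ∈ S.generator) :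
    S.orbitIntegral hS h w.2 = S.toFun h.toNNReal w.1 - w.1 := by
  have hw' : Tendsto (fun t : ℝ≥0 => (t : ℝ)⁻¹ • (S.toFun t w.1 - w.1)) (𝓝[>] 0) (𝓝 w.2) := hw
  have h1 := ((S.orbitIntegral hS h).continuous.tendsto w.2).comp hw'
  have h2 : Tendsto (fun t : ℝ≥0 => (t : ℝ)⁻¹ •
      (S.toFun t (S.orbitIntegral hS h w.1) - S.orbitIntegral hS h w.1)) (𝓝[>] 0)
      (𝓝 (S.toFun h.toNNReal w.1 - w.1)) := S.orbitIntegral_mem_generator hS hh w.1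
  refine tendsto_nhds_unique h1 (h2.congr fun t => ?_)
  have hcomm : S.orbitIntegral hS h (S.toFun t w.1) = S.toFun t (S.orbitIntegral hS h w.1) := by
    rw [orbitIntegral_apply, orbitIntegral_apply, ← ContinuousLinearMap.intervalIntegral_comp_comm
      _ ((S.continuous_orbit_toNNReal _).intervalIntegrable _ _)]
    refine intervalIntegral.integral_congr fun s _ => ?_
    change (S.toFun _).comp (S.toFun t) _ = (S.toFun t).comp (S.toFun _) _
    rw [← S.map_add, ← S.map_add, add_comm]
  simp only [Function.comp_apply, map_smul, map_sub, hcomm]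

/-- Averaging any functional along the adjoint orbit puts it in D(A^*), which is the supply of
elements needed for separation of points. -/
theorem C0Semigroup.comp_orbitIntegral_mem_adjointGenerator [CompleteSpace X]
    (S : C0Semigroup X) (hS : S.IsContraction) {h : ℝ} (hh : 0 ≤ h) (x' : StrongDual ℝ X) :
    (x'.comp (S.orbitIntegral hS h), x'.comp (S.toFun h.toNNReal) - x') ∈
      S.adjointGenerator := by
  intro w hw
  change x' (S.orbitIntegral hS h w.2) = x' (S.toFun _ w.1) - x' w.1
  rw [S.orbitIntegral_apply_generator hS hh hw, map_sub]

/-- The domain of the adjoint of the generator separates the points of `X`. -/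
theorem C0Semigroup.eq_zero_of_forall_adjointGenerator [CompleteSpace X] (S : C0Semigroup X)
    (hS : S.IsContraction) {x : X} (hx : ∀ z ∈ S.adjointGenerator, z.1 x = 0) : x = 0 := by
  have h1 : ∀ h : ℝ, 0 ≤ h → S.orbitIntegral hS h x = 0 := fun h hh =>
    SeparatingDual.eq_zero_of_forall_dual_eq_zero (R := ℝ) fun x' =>
      hx _ (S.comp_orbitIntegral_mem_adjointGenerator hS hh x')
  have h2 := (S.hasDerivAt_orbitIntegral hS x 0).tendsto_slope_zero_right
  rw [Real.toNNReal_zero, S.map_zero] at h2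
  refine tendsto_nhds_unique h2 (tendsto_const_nhds.congr' ?_)
  filter_upwards [self_mem_nhdsWithin] with t ht
  rw [h1 _ (by rw [zero_add]; exact (Set.mem_Ioi.1 ht).le), h1 0 le_rfl, sub_zero, smul_zero]

/-- The graph of the adjoint of the generator as a subspace. -/
def C0Semigroup.adjointSubmodule (S : C0Semigroup X) :
    Submodule ℝ (StrongDual ℝ X × StrongDual ℝ X) where
  carrier := S.adjointGenerator
  add_mem' := fun {a b} ha hb w hw => by
    change a.1 w.2 + b.1 w.2 = a.2 w.1 + b.2 w.1
    rw [ha w hw, hb w hw]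
  zero_mem' := fun w _ => rfl
  smul_mem' := fun c a ha w hw => by
    change c * a.1 w.2 = c * a.2 w.1
    rw [ha w hw]

theorem C0Semigroup.adjoint_orbit_sub [CompleteSpace X] (S : C0Semigroup X)
    (hS : S.IsContraction) {z : StrongDual ℝ X × StrongDual ℝ X} (hz : z ∈ S.adjointGenerator)
    {t : ℝ} (ht : 0 ≤ t) (x : X) :
    z.1 (S.toFun t.toNNReal x) - z.1 x = ∫ s in (0 : ℝ)..t, z.2 (S.toFun s.toNNReal x) := by
  rw [← map_sub, hz _ (S.orbitIntegral_mem_generator hS ht x), S.orbitIntegral_apply,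
    ContinuousLinearMap.intervalIntegral_comp_comm _
      ((S.continuous_orbit_toNNReal _).intervalIntegrable _ _)]

/-- The adjoint semigroup need not be strongly continuous on the dual, but orbits starting in D(A^*)
are norm Lipschitz. -/
theorem C0Semigroup.norm_adjoint_orbit_sub_le [CompleteSpace X] (S : C0Semigroup X)
    (hS : S.IsContraction) {z : StrongDual ℝ X × StrongDual ℝ X} (hz : z ∈ S.adjointGenerator)
    {s t : ℝ} (hs : 0 ≤ s) (ht : 0 ≤ t) :
    ‖z.1.comp (S.toFun t.toNNReal) - z.1.comp (S.toFun s.toNNReal)‖ ≤ ‖z.2‖ * |t - s| := by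
  refine ContinuousLinearMap.opNorm_le_bound _ (by positivity) fun x => ?_
  change ‖z.1 (S.toFun t.toNNReal x) - z.1 (S.toFun s.toNNReal x)‖ ≤ _
  have hint := fun a b => (z.2.continuous.comp
    (S.continuous_orbit_toNNReal x)).intervalIntegrable (μ := volume) a b
  have h1 : z.1 (S.toFun t.toNNReal x) - z.1 (S.toFun s.toNNReal x) =
      ∫ r in s..t, z.2 (S.toFun r.toNNReal x) := by
    rw [← sub_sub_sub_cancel_right _ _ (z.1 x), S.adjoint_orbit_sub hS hz ht,
      S.adjoint_orbit_sub hS hz hs]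
    exact intervalIntegral.integral_interval_sub_left (hint _ _) (hint _ _)
  rw [h1, mul_right_comm]
  exact intervalIntegral.norm_integral_le_of_norm_le_const fun r _ =>
    (z.2.le_opNorm _).trans (mul_le_mul_of_nonneg_left (hS.norm_le _ _) (norm_nonneg _))

theorem C0Semigroup.continuous_adjoint_orbit [CompleteSpace X] (S : C0Semigroup X)
    (hS : S.IsContraction) {z : StrongDual ℝ X × StrongDual ℝ X}
    (hz : z ∈ S.adjointGenerator) :
    Continuous fun t : ℝ => z.1.comp (S.toFun t.toNNReal) := by
  refine (LipschitzWith.of_dist_le_mul (K := ‖z.2‖₊) fun s t : ℝ≥0 => ?_ :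
    LipschitzWith _ fun t : ℝ≥0 => z.1.comp (S.toFun t)).continuous.comp continuous_real_toNNReal
  have := S.norm_adjoint_orbit_sub_le hS hz t.2 s.2
  rw [dist_eq_norm, NNReal.dist_eq]
  simpa using this

theorem C0Semigroup.hasDerivAt_adjoint_orbit [CompleteSpace X] (S : C0Semigroup X)
    (hS : S.IsContraction) {z : StrongDual ℝ X × StrongDual ℝ X} (hz : z ∈ S.adjointGenerator)
    {s : ℝ} (hs : 0 < s) (x : X) :
    HasDerivAt (fun t : ℝ => z.1 (S.toFun t.toNNReal x)) (z.2 (S.toFun s.toNNReal x)) s := by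
  have h1 : HasDerivAt (fun t : ℝ => z.1 x + ∫ r in (0 : ℝ)..t, z.2 (S.toFun r.toNNReal x))
      (z.2 (S.toFun s.toNNReal x)) s :=
    ((z.2.continuous.comp (S.continuous_orbit_toNNReal x)).integral_hasStrictDerivAt 0
      s).hasDerivAt.const_add _
  refine h1.congr_of_eventuallyEq ?_
  filter_upwards [Ioi_mem_nhds hs] with t ht
  rw [← S.adjoint_orbit_sub hS hz (Set.mem_Ioi.1 ht).le]
  ring

/-- By the mean value theorem f takes the value ∫ f over [n, n+1] at some point beyond n, and these
integrals tend to 0. -/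
theorem eq_zero_of_tendsto_integral {f : ℝ → ℝ} (hf : Continuous f) {a l : ℝ}
    (h1 : Tendsto (fun t => ∫ s in (0 : ℝ)..t, f s) atTop (𝓝 a)) (h2 : Tendsto f atTop (𝓝 l)) :
    l = 0 := by
  have hd : ∀ t, HasDerivAt (fun t => ∫ s in (0 : ℝ)..t, f s) (f t) t := fun t =>
    (hf.integral_hasStrictDerivAt 0 t).hasDerivAt
  have hc : ∀ n : ℕ, ∃ c : ℝ, (n : ℝ) < c ∧
      f c = (∫ s in (0 : ℝ)..(n + 1), f s) - ∫ s in (0 : ℝ)..n, f s := by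
    intro n
    obtain ⟨c, hc, h⟩ := exists_hasDerivAt_eq_slope (fun t => ∫ s in (0 : ℝ)..t, f s) f
      (lt_add_one (n : ℝ)) (fun t _ => (hd t).continuousAt.continuousWithinAt) fun t _ => hd t
    exact ⟨c, hc.1, by rw [h]; simp⟩
  choose c hc1 hc2 using hc
  have hcat : Tendsto c atTop atTop :=
    tendsto_atTop_mono (fun n => (hc1 n).le) tendsto_natCast_atTop_atTop
  have h3 := h2.comp hcat
  have h4 := (h1.comp (tendsto_natCast_atTop_atTop (R := ℝ) |>.atTop_add
    (tendsto_const_nhds (x := (1 : ℝ))))).sub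
      (h1.comp (tendsto_natCast_atTop_atTop (R := ℝ)))
  rw [sub_self] at h4
  exact tendsto_nhds_unique h3 (h4.congr fun n => (hc2 n).symm)

/-- The Lyapunov equation `2 ⟨Q_∞ x', A^* x'⟩ = -⟨Q x', x'⟩`. -/
theorem lyapunov [CompleteSpace X] (Q : PosSymOp X) (S : C0Semigroup X) (hS : S.IsContraction)
    (Qinf : StrongDual ℝ X → X)
    (hQinf : ∀ x' y' : StrongDual ℝ X,
      Tendsto (fun t : ℝ => y' (covAt Q S t x')) atTop (𝓝 (y' (Qinf x'))))
    {z : StrongDual ℝ X × StrongDual ℝ X} (hz : z ∈ S.adjointGenerator) :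
    2 * z.2 (Qinf z.1) = -z.1 (Q.toCLM z.1) := by
  let q : ℝ → StrongDual ℝ X := fun t => z.1.comp (S.toFun t.toNNReal)
  have hq : Continuous q := S.continuous_adjoint_orbit hS hz
  let g : ℝ → X := fun s => S.toFun s.toNNReal (Q.toCLM (q s))
  have hg : Continuous g := hS.continuous_apply (Q.toCLM.continuous.comp hq)
  have hcov : ∀ (y' : StrongDual ℝ X) (t : ℝ),
      y' (covAt Q S t z.1) = ∫ s in (0 : ℝ)..t, y' (g s) := fun y' t =>
    (ContinuousLinearMap.intervalIntegral_comp_comm y' (hg.intervalIntegrable _ _)).symm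
  -- f(t) = ⟨Q q(t), q(t)⟩ along the adjoint orbit q. Its integral over [0, t] is ⟨Q_t x', x'⟩ and
  -- its derivative integrates to 2⟨Q_t x', A^* x'⟩; both converge, so f converges with limit 0.
  let f : ℝ → ℝ := fun t => q t (Q.toCLM (q t))
  have hf : Continuous f := hq.clm_apply (Q.toCLM.continuous.comp hq)
  have hfd : ∀ s : ℝ, 0 < s → HasDerivAt f (2 * z.2 (g s)) s := by
    intro s hs
    -- q is only weak-* differentiable. By symmetry of Q, f(t) is an affine function of q(t) plus
    -- the quadratic term in q(t) - q(s), and the latter is O(|t - s|²) by the Lipschitz bound.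
    have h1 : HasDerivAt (fun t => 2 * q t (Q.toCLM (q s)) - f s) (2 * z.2 (g s)) s :=
      ((S.hasDerivAt_adjoint_orbit hS hz hs (Q.toCLM (q s))).const_mul 2).sub_const _
    have h2 : HasDerivAt (fun t => (q t - q s) (Q.toCLM (q t - q s))) 0 s := by
      have hO : (fun t => (q t - q s) (Q.toCLM (q t - q s))) =O[𝓝 s] fun t => ‖t - s‖ ^ 2 := by
        refine Asymptotics.IsBigO.of_bound (‖Q.toCLM‖ * ‖z.2‖ ^ 2) ?_
        filter_upwards [Ioi_mem_nhds hs] with t ht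
        have h3 := S.norm_adjoint_orbit_sub_le hS hz hs.le (Set.mem_Ioi.1 ht).le
        change ‖q t - q s‖ ≤ _ at h3
        rw [norm_pow, norm_norm, Real.norm_eq_abs (t - s)]
        calc _ ≤ ‖q t - q s‖ * (‖Q.toCLM‖ * ‖q t - q s‖) :=
              ((q t - q s).le_opNorm _).trans
                (mul_le_mul_of_nonneg_left (Q.toCLM.le_opNorm _) (norm_nonneg _))
          _ = ‖Q.toCLM‖ * ‖q t - q s‖ ^ 2 := by ring
          _ ≤ ‖Q.toCLM‖ * (‖z.2‖ * |t - s|) ^ 2 := by gcongr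
          _ = _ := by ring
      exact (hO.hasFDerivAt one_lt_two).hasDerivAt.congr_deriv (by simp)
    have h3 := h1.add h2
    rw [add_zero] at h3
    refine h3.congr_of_eventuallyEq (Eventually.of_forall fun t => ?_)
    have h4 := Q.symm (q s) (q t)
    simp only [Pi.add_apply, sub_apply, map_sub, f]
    linarith
  have hfint : ∀ t : ℝ, 0 ≤ t → f t = f 0 + 2 * z.2 (covAt Q S t z.1) := by
    intro t ht
    have h1 := intervalIntegral.integral_eq_sub_of_hasDerivAt_of_le ht hf.continuousOn
      (fun s hs => hfd s hs.1)
      (((z.2.continuous.comp hg).const_mul 2).intervalIntegrable 0 t)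
    rw [intervalIntegral.integral_const_mul, ← hcov] at h1
    linarith
  have hlim : Tendsto f atTop (𝓝 (f 0 + 2 * z.2 (Qinf z.1))) := by
    refine (((hQinf z.1 z.2).const_mul 2).const_add (f 0)).congr' ?_
    filter_upwards [eventually_ge_atTop 0] with t ht
    exact (hfint t ht).symm
  have hint : Tendsto (fun t => ∫ s in (0 : ℝ)..t, f s) atTop (𝓝 (z.1 (Qinf z.1))) :=
    (hQinf z.1 z.1).congr fun t => hcov z.1 t
  have h0 := eq_zero_of_tendsto_integral hf hint hlim
  have hf0 : f 0 = z.1 (Q.toCLM z.1) := by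
    simp only [f, q, Real.toNNReal_zero, S.map_zero, ContinuousLinearMap.comp_id]
  rw [hf0] at h0
  linarith

/-- Injectivity of j makes the preimages of L v unique, hence linear in v; the norm bound lets the
resulting map extend from the dense range of e, and the quadratic identity is a closed condition. -/
theorem exists_clm_of_dense {V H Y : Type*} [AddCommGroup V] [Module ℝ V]
    [NormedAddCommGroup H] [InnerProductSpace ℝ H] [CompleteSpace H] [AddCommGroup Y] [Module ℝ Y]
    (e : V →ₗ[ℝ] H) (he : ∀ h, (∀ v, inner ℝ (e v) h = 0) → h = 0) {j : H →ₗ[ℝ] Y}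
    (hj : Function.Injective j) (L : V →ₗ[ℝ] Y) {C : ℝ}
    (hL : ∀ v, ∃ h, j h = L v ∧ ‖h‖ ≤ C * ‖e v‖)
    (hR : ∀ v h, j h = L v → -inner ℝ h (e v) = 1 / 2 * ‖e v‖ ^ 2) :
    ∃ B : H →L[ℝ] H, (∀ v, j (B (e v)) = L v) ∧ ∀ h, -inner ℝ (B h) h = 1 / 2 * ‖h‖ ^ 2 := by
  choose r hr1 hr2 using hL
  let R : V →ₗ[ℝ] H :=
    { toFun := r
      map_add' := fun z w => hj (by rw [map_add, hr1, hr1, hr1, map_add])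
      map_smul' := fun a z => hj (by rw [RingHom.id_apply, map_smul, hr1, hr1, map_smul]) }
  have hd : DenseRange e := by
    have h1 : Dense (LinearMap.range e : Set H) := by
      rw [Submodule.dense_iff_topologicalClosure_eq_top,
        Submodule.topologicalClosure_eq_top_iff, Submodule.eq_bot_iff]
      exact fun h hh => he h fun v => (Submodule.mem_orthogonal _ _).1 hh _ ⟨v, rfl⟩
    exact h1
  have hB : ∀ v, R.extendOfNorm e (e v) = r v :=
    LinearMap.extendOfNorm_eq (f := R) hd ⟨C, hr2⟩
  refine ⟨R.extendOfNorm e, fun v => by rw [hB, hr1], fun h => ?_⟩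
  refine hd.induction_on (p := fun h => -inner ℝ (R.extendOfNorm e h) h = 1 / 2 * ‖h‖ ^ 2) h
    (isClosed_eq (by fun_prop) (by fun_prop)) fun v => ?_
  rw [hB, hR _ _ (hr1 v)]

/-- Linearity and symmetry of Q_∞ are read off its being a covariance. Pairing Q_∞ A^* x' with i^*
x' and using symmetry produces ⟨Q_∞ x', A^* x'⟩, which the Lyapunov equation evaluates. -/
theorem exists_driftOperator [CompleteSpace X] [MeasurableSpace X] [BorelSpace X]
    (Q : PosSymOp X) (S : C0Semigroup X)
    (hS : S.IsContraction) (Qinf : StrongDual ℝ X → X)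
    (hQinf : ∀ x' y' : StrongDual ℝ X,
      Tendsto (fun t : ℝ => y' (covAt Q S t x')) atTop (𝓝 (y' (Qinf x'))))
    (μ : Measure X) (hμ : IsCentredGaussian μ Qinf)
    (hRKH : ∃ c : ℝ, 0 < c ∧ ∀ z ∈ S.adjointGenerator, ∃ h : RKHS Q,
      RKHS.embed Q h = Qinf z.2 ∧ ‖h‖ ≤ c * ‖RKHS.iStar Q z.1‖) :
    ∃ B : RKHS Q →L[ℝ] RKHS Q, IsDriftOperator Q S Qinf B ∧
      ∀ h, -inner ℝ (B h) h = 1 / 2 * ‖h‖ ^ 2 := by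
  obtain ⟨hG, -, hcov⟩ := hμ
  obtain ⟨c, -, hc⟩ := hRKH
  have hmul : ∀ x' y' : StrongDual ℝ X, Integrable (fun x => x' x * y' x) μ := fun x' y' =>
    (IsGaussian.memLp_dual μ x' 2 (by norm_num)).integrable_mul
      (IsGaussian.memLp_dual μ y' 2 (by norm_num))
  have hadd : ∀ x' y', Qinf (x' + y') = Qinf x' + Qinf y' := by
    intro x' y'
    refine (SeparatingDual.eq_iff_forall_dual_eq (R := ℝ)).2 fun v' => ?_
    rw [map_add, ← hcov, ← hcov, ← hcov, ← integral_add (hmul _ _) (hmul _ _)]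
    simp only [add_apply, add_mul]
  have hsmul : ∀ (a : ℝ) (x'), Qinf (a • x') = a • Qinf x' := by
    intro a x'
    refine (SeparatingDual.eq_iff_forall_dual_eq (R := ℝ)).2 fun v' => ?_
    rw [map_smul, ← hcov, ← hcov, smul_eq_mul, ← integral_const_mul]
    simp only [smul_apply, smul_eq_mul, mul_assoc]
  have hsymm : ∀ x' y' : StrongDual ℝ X, y' (Qinf x') = x' (Qinf y') := by
    intro x' y'
    rw [← hcov, ← hcov]
    simp only [mul_comm]
  let L : S.adjointSubmodule →ₗ[ℝ] X :=
    { toFun := fun z => Qinf z.1.2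
      map_add' := fun z w => hadd _ _
      map_smul' := fun a z => hsmul _ _ }
  obtain ⟨B, hB, hB'⟩ := exists_clm_of_dense (V := S.adjointSubmodule) (H := RKHS Q)
    (RKHS.iStar Q ∘ₗ LinearMap.fst ℝ _ _ ∘ₗ S.adjointSubmodule.subtype)
    (fun h hh => RKHS.embed_injective Q (by
      rw [map_zero]
      refine S.eq_zero_of_forall_adjointGenerator hS fun z hz => ?_
      rw [← RKHS.inner_iStar_right, real_inner_comm]
      exact hh ⟨z, hz⟩))
    (j := (RKHS.embed Q).toLinearMap) (RKHS.embed_injective Q) L (C := c)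
    (fun z => hc z.1 z.2) (fun z h hh => by
      change -inner ℝ h (RKHS.iStar Q z.1.1) = 1 / 2 * ‖RKHS.iStar Q z.1.1‖ ^ 2
      rw [RKHS.inner_iStar_right, show RKHS.embed Q h = Qinf z.1.2 from hh, hsymm,
        ← real_inner_self_eq_norm_sq, RKHS.inner_iStar]
      have := lyapunov Q S hS Qinf hQinf z.2
      linarith)
  exact ⟨B, fun z hz => hB ⟨z, hz⟩, hB'⟩

end Drift

end WeightedOU

namespace WeightedOU

/-! ### Finiteness of the weighted measure -/

section Weight

variable {X : Type*} [NormedAddCommGroup X] [NormedSpace ℝ X]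

/-- Hahn-Banach: separate the closed convex epigraph of U from a point just below it. -/
theorem exists_affine_le {U : X → EReal} (hbot : ∀ x, U x ≠ ⊥) (htop : ∃ x, U x ≠ ⊤)
    (hlsc : LowerSemicontinuous U) (hconv : Convex ℝ {z : X × ℝ | U z.1 ≤ (z.2 : EReal)}) :
    ∃ (x' : StrongDual ℝ X) (c : ℝ), ∀ x, ((x' x + c : ℝ) : EReal) ≤ U x := by
  obtain ⟨x₀, hx₀⟩ := htop
  have hclosed : IsClosed {z : X × ℝ | U z.1 ≤ (z.2 : EReal)} :=
    hlsc.isClosed_epigraph.preimage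
      (continuous_fst.prodMk (continuous_coe_real_ereal.comp continuous_snd))
  have hU₀ : U x₀ = ((U x₀).toReal : EReal) := (EReal.coe_toReal hx₀ (hbot x₀)).symm
  have hnot : (x₀, (U x₀).toReal - 1) ∉ {z : X × ℝ | U z.1 ≤ (z.2 : EReal)} := by
    intro h
    change U x₀ ≤ _ at h
    rw [hU₀, EReal.coe_le_coe_iff, EReal.toReal_coe] at h
    linarith
  obtain ⟨g, u, hg, hu⟩ := geometric_hahn_banach_closed_point hconv hclosed hnot
  let a : ℝ := g (0, 1)
  let y' : StrongDual ℝ X := g.comp (ContinuousLinearMap.inl ℝ X ℝ)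
  have hdec : ∀ (x : X) (r : ℝ), g (x, r) = y' x + r * a := by
    intro x r
    have h : (x, r) = (x, (0 : ℝ)) + r • ((0 : X), (1 : ℝ)) := by simp
    rw [h, map_add, map_smul]
    rfl
  have h0 : g (x₀, (U x₀).toReal) < u := hg _ (by
    change U x₀ ≤ _
    exact hU₀.le)
  rw [hdec] at h0 hu
  -- The functional is larger at height U(x₀) - 1 than at U(x₀), so the hyperplane is not vertical
  -- and can be solved for the height.
  have ha : a < 0 := by linarith
  refine ⟨(-a)⁻¹ • y', -((-a)⁻¹ * u), fun x => ?_⟩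
  by_cases hx : U x = ⊤
  · rw [hx]; exact le_top
  · have hUx : U x = ((U x).toReal : EReal) := (EReal.coe_toReal hx (hbot x)).symm
    have h1 : g (x, (U x).toReal) < u := hg _ (by
      change U x ≤ _
      exact hUx.le)
    rw [hdec] at h1
    rw [hUx, EReal.coe_le_coe_iff, smul_apply, smul_eq_mul, ← sub_eq_add_neg, ← mul_sub,
      inv_mul_le_iff₀ (by linarith)]
    linarith

theorem isFiniteMeasure_weighted [MeasurableSpace X] [BorelSpace X] {μ : Measure X}
    [IsGaussian μ] {U : X → EReal} {x' : StrongDual ℝ X} {c : ℝ}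
    (h : ∀ x, ((x' x + c : ℝ) : EReal) ≤ U x) : IsFiniteMeasure (weighted μ U) := by
  refine isFiniteMeasure_withDensity (ne_top_of_le_ne_top (b := ∫⁻ x, ENNReal.ofReal
    (Real.exp (-c) * Real.exp ((-1) * x' x)) ∂μ) ?_ (lintegral_mono fun x => ?_))
  · refine (Integrable.lintegral_lt_top (Integrable.const_mul ?_ _)).ne
    have h1 : Integrable (fun r : ℝ => Real.exp ((-1) * r)) (μ.map x') := by
      rw [IsGaussian.map_eq_gaussianReal]
      exact integrable_exp_mul_gaussianReal _
    exact h1.comp_measurable x'.continuous.measurable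
  · rw [← Real.exp_add, ← EReal.exp_coe]
    refine EReal.exp_monotone ?_
    rw [EReal.neg_le]
    refine le_trans (le_of_eq ?_) (h x)
    rw [← EReal.coe_neg]
    congr 1
    ring

end Weight

/-! ### Cylindrical functions -/

section Cylindrical

variable {X : Type*} [NormedAddCommGroup X] [NormedSpace ℝ X]

theorem cylindrical_regular {f : X → ℝ} (hf : f ∈ cylindrical X) :
    ContDiff ℝ 1 f ∧ (∃ C : ℝ, ∀ x, |f x| ≤ C) ∧ ∃ C : ℝ, ∀ x, ‖fderiv ℝ f x‖ ≤ C := by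
  obtain ⟨n, φ, x', ⟨hφ, ⟨C, hC⟩, ⟨D, hD⟩⟩, rfl⟩ := hf
  let A : X →L[ℝ] (Fin n → ℝ) := ContinuousLinearMap.pi x'
  refine ⟨hφ.comp A.contDiff, ⟨C, fun x => hC _⟩, ⟨D * ‖A‖, fun x => ?_⟩⟩
  have h : HasFDerivAt (fun x => φ (A x)) ((fderiv ℝ φ (A x)).comp A) x :=
    ((hφ.differentiable one_ne_zero) (A x)).hasFDerivAt.comp x A.hasFDerivAt
  change ‖fderiv ℝ (fun x => φ (A x)) x‖ ≤ _
  rw [h.fderiv]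
  exact (ContinuousLinearMap.opNorm_comp_le _ _).trans
    (mul_le_mul_of_nonneg_right (hD _) (norm_nonneg _))

theorem zero_mem_cylindrical : (fun _ => 0 : X → ℝ) ∈ cylindrical X :=
  ⟨0, fun _ => 0, Fin.elim0, ⟨contDiff_const, ⟨0, by simp⟩, ⟨0, by simp⟩⟩, rfl⟩

theorem comp_mem_cylindrical {f : X → ℝ} (hf : f ∈ cylindrical X) {ψ : ℝ → ℝ}
    (hψ : ContDiff ℝ 1 ψ) (hb : ∃ C, ∀ r, |ψ r| ≤ C) (hd : ∃ C, ∀ r, |deriv ψ r| ≤ C) :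
    (fun x => ψ (f x)) ∈ cylindrical X := by
  obtain ⟨n, φ, x', ⟨hφ, -, ⟨D, hD⟩⟩, rfl⟩ := hf
  obtain ⟨C, hC⟩ := hb
  obtain ⟨C', hC'⟩ := hd
  refine ⟨n, fun ξ => ψ (φ ξ), x', ⟨hψ.comp hφ, ⟨C, fun ξ => hC _⟩, ⟨C' * D, fun ξ => ?_⟩⟩, rfl⟩
  have h : HasFDerivAt (fun ξ => ψ (φ ξ)) (deriv ψ (φ ξ) • fderiv ℝ φ ξ) ξ :=
    ((hψ.differentiable one_ne_zero) (φ ξ)).hasDerivAt.comp_hasFDerivAt ξ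
      ((hφ.differentiable one_ne_zero) ξ).hasFDerivAt
  rw [h.fderiv, norm_smul]
  exact mul_le_mul (hC' _) (hD _) (norm_nonneg _) ((abs_nonneg _).trans (hC' 0))

theorem smul_mem_cylindrical {f : X → ℝ} (hf : f ∈ cylindrical X) (c : ℝ) :
    (fun x => c * f x) ∈ cylindrical X := by
  obtain ⟨n, φ, x', ⟨hφ, ⟨C, hC⟩, ⟨D, hD⟩⟩, rfl⟩ := hf
  refine ⟨n, fun ξ => c * φ ξ, x', ⟨contDiff_const.mul hφ, ⟨|c| * C, fun ξ => ?_⟩,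
    ⟨|c| * D, fun ξ => ?_⟩⟩, rfl⟩
  · rw [abs_mul]
    exact mul_le_mul_of_nonneg_left (hC ξ) (abs_nonneg c)
  · have h : HasFDerivAt (fun ξ => c * φ ξ) (c • fderiv ℝ φ ξ) ξ :=
      ((hφ.differentiable one_ne_zero) ξ).hasFDerivAt.const_mul c
    rw [h.fderiv, norm_smul]
    exact mul_le_mul_of_nonneg_left (hD ξ) (abs_nonneg c)

theorem add_mem_cylindrical {f g : X → ℝ} (hf : f ∈ cylindrical X) (hg : g ∈ cylindrical X) :
    (fun x => f x + g x) ∈ cylindrical X := by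
  obtain ⟨n, φ, x', ⟨hφ, ⟨C, hC⟩, ⟨D, hD⟩⟩, rfl⟩ := hf
  obtain ⟨m, φ', y', ⟨hφ', ⟨C', hC'⟩, ⟨D', hD'⟩⟩, rfl⟩ := hg
  let A : (Fin (n + m) → ℝ) →L[ℝ] (Fin n → ℝ) :=
    ContinuousLinearMap.pi fun i => ContinuousLinearMap.proj (Fin.castAdd m i)
  let A' : (Fin (n + m) → ℝ) →L[ℝ] (Fin m → ℝ) :=
    ContinuousLinearMap.pi fun i => ContinuousLinearMap.proj (Fin.natAdd n i)
  refine ⟨n + m, fun ξ => φ (A ξ) + φ' (A' ξ), Fin.append x' y',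
    ⟨(hφ.comp A.contDiff).add (hφ'.comp A'.contDiff), ⟨C + C', fun ξ => ?_⟩,
      ⟨D * ‖A‖ + D' * ‖A'‖, fun ξ => ?_⟩⟩, ?_⟩
  · exact (abs_add_le _ _).trans (add_le_add (hC _) (hC' _))
  · have h : HasFDerivAt (fun ξ => φ (A ξ) + φ' (A' ξ))
        ((fderiv ℝ φ (A ξ)).comp A + (fderiv ℝ φ' (A' ξ)).comp A') ξ :=
      (((hφ.differentiable one_ne_zero) (A ξ)).hasFDerivAt.comp ξ A.hasFDerivAt).add
        (((hφ'.differentiable one_ne_zero) (A' ξ)).hasFDerivAt.comp ξ A'.hasFDerivAt)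
    rw [h.fderiv]
    refine (norm_add_le _ _).trans (add_le_add ?_ ?_)
    · exact (ContinuousLinearMap.opNorm_comp_le _ _).trans
        (mul_le_mul_of_nonneg_right (hD _) (norm_nonneg _))
    · exact (ContinuousLinearMap.opNorm_comp_le _ _).trans
        (mul_le_mul_of_nonneg_right (hD' _) (norm_nonneg _))
  · funext x
    have h1 : (A fun j => Fin.append x' y' j x) = fun j => x' j x := by
      funext i
      change Fin.append x' y' (Fin.castAdd m i) x = _
      rw [Fin.append_left]
    have h2 : (A' fun j => Fin.append x' y' j x) = fun j => y' j x := by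
      funext i
      change Fin.append x' y' (Fin.natAdd n i) x = _
      rw [Fin.append_right]
    change _ = φ (A fun j => Fin.append x' y' j x) + φ' (A' fun j => Fin.append x' y' j x)
    rw [h1, h2]

theorem cylindrical_of_dual (x' : StrongDual ℝ X) {ψ : ℝ → ℝ} (hψ : ContDiff ℝ 1 ψ)
    (hb : ∃ C, ∀ r, |ψ r| ≤ C) (hd : ∃ C, ∀ r, |deriv ψ r| ≤ C) :
    (fun x => ψ (x' x)) ∈ cylindrical X := by
  obtain ⟨C, hC⟩ := hb
  obtain ⟨D, hD⟩ := hd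
  let A : (Fin 1 → ℝ) →L[ℝ] ℝ := ContinuousLinearMap.proj 0
  refine ⟨1, fun ξ => ψ (A ξ), fun _ => x', ⟨hψ.comp A.contDiff, ⟨C, fun ξ => hC _⟩,
    ⟨D * ‖A‖, fun ξ => ?_⟩⟩, rfl⟩
  have h : HasFDerivAt (fun ξ => ψ (A ξ)) (deriv ψ (A ξ) • A) ξ :=
    ((hψ.differentiable one_ne_zero) (A ξ)).hasDerivAt.comp_hasFDerivAt ξ A.hasFDerivAt
  rw [h.fderiv, norm_smul]
  exact mul_le_mul_of_nonneg_right (hD _) (norm_nonneg _)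

theorem norm_iStar_le (Q : PosSymOp X) (x' : StrongDual ℝ X) :
    ‖RKHS.iStar Q x'‖ ≤ Real.sqrt ‖Q.toCLM‖ * ‖x'‖ := by
  refine abs_le_of_sq_le_sq' ?_ (by positivity) |>.2
  rw [← real_inner_self_eq_norm_sq, RKHS.inner_iStar, mul_pow, Real.sq_sqrt (norm_nonneg Q.toCLM)]
  calc x' (Q.toCLM x') ≤ ‖x' (Q.toCLM x')‖ := le_abs_self _
    _ ≤ ‖x'‖ * (‖Q.toCLM‖ * ‖x'‖) :=
        (x'.le_opNorm _).trans (mul_le_mul_of_nonneg_left (Q.toCLM.le_opNorm _) (norm_nonneg _))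
    _ = _ := by ring

theorem continuous_iStar (Q : PosSymOp X) : Continuous (RKHS.iStar Q) :=
  AddMonoidHomClass.continuous_of_bound (RKHS.iStar Q) _ (norm_iStar_le Q)

theorem continuous_gradCyl (Q : PosSymOp X) {f : X → ℝ} (hf : f ∈ cylindrical X) :
    Continuous (gradCyl Q f) :=
  (continuous_iStar Q).comp ((cylindrical_regular hf).1.continuous_fderiv one_ne_zero)

theorem gradCyl_comp (Q : PosSymOp X) {f : X → ℝ} (hf : f ∈ cylindrical X) {ψ : ℝ → ℝ}
    (hψ : ContDiff ℝ 1 ψ) (x : X) :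
    gradCyl Q (fun x => ψ (f x)) x = deriv ψ (f x) • gradCyl Q f x := by
  have h : HasFDerivAt (fun x => ψ (f x)) (deriv ψ (f x) • fderiv ℝ f x) x :=
    ((hψ.differentiable one_ne_zero) (f x)).hasDerivAt.comp_hasFDerivAt x
      (((cylindrical_regular hf).1.differentiable one_ne_zero) x).hasFDerivAt
  rw [gradCyl, h.fderiv, map_smul]
  rfl

theorem gradCyl_add (Q : PosSymOp X) {f g : X → ℝ} (hf : f ∈ cylindrical X)
    (hg : g ∈ cylindrical X) (x : X) :
    gradCyl Q (fun x => f x + g x) x = gradCyl Q f x + gradCyl Q g x := by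
  have h : HasFDerivAt (fun x => f x + g x) (fderiv ℝ f x + fderiv ℝ g x) x :=
    (((cylindrical_regular hf).1.differentiable one_ne_zero) x).hasFDerivAt.add
      (((cylindrical_regular hg).1.differentiable one_ne_zero) x).hasFDerivAt
  rw [gradCyl, h.fderiv, map_add]
  rfl

theorem gradCyl_smul (Q : PosSymOp X) {f : X → ℝ} (hf : f ∈ cylindrical X) (c : ℝ) (x : X) :
    gradCyl Q (fun x => c * f x) x = c • gradCyl Q f x := by
  have h : HasFDerivAt (fun x => c * f x) (c • fderiv ℝ f x) x :=
    (((cylindrical_regular hf).1.differentiable one_ne_zero) x).hasFDerivAt.const_mul c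
  rw [gradCyl, h.fderiv, map_smul]
  rfl

variable [MeasurableSpace X] [BorelSpace X] {ν : Measure X}
  [IsFiniteMeasure ν]

theorem memLp_cylindrical {f : X → ℝ} (hf : f ∈ cylindrical X) (p : ℝ≥0∞) : MemLp f p ν := by
  obtain ⟨hc, ⟨C, hC⟩, -⟩ := cylindrical_regular hf
  exact MemLp.of_bound hc.continuous.measurable.aestronglyMeasurable C (Eventually.of_forall hC)

theorem memLp_gradCyl [TopologicalSpace.SeparableSpace X] (Q : PosSymOp X) {f : X → ℝ}
    (hf : f ∈ cylindrical X) (p : ℝ≥0∞) : MemLp (gradCyl Q f) p ν := by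
  have : SecondCountableTopology X := UniformSpace.secondCountable_of_separable X
  obtain ⟨hc, -, ⟨C, hC⟩⟩ := cylindrical_regular hf
  exact MemLp.of_bound (continuous_gradCyl Q hf).aestronglyMeasurable (√‖Q.toCLM‖ * C)
    (Eventually.of_forall fun x => (norm_iStar_le Q _).trans
      (mul_le_mul_of_nonneg_left (hC x) (Real.sqrt_nonneg _)))

/-- The cylindrical functions are dense in `L²`. -/
theorem eq_zero_of_forall_cylindrical [CompleteSpace X] [TopologicalSpace.SeparableSpace X]
    (f : Lp ℝ 2 ν) (hf : ∀ v ∈ cylindrical X, ∫ x, f x * v x ∂ν = 0) : f = 0 := by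
  have : SecondCountableTopology X := UniformSpace.secondCountable_of_separable X
  have hint : Integrable f ν := integrable_coeFn f
  have hneg : Integrable (fun x => -f x) ν := hint.neg
  -- cos(L x) and sin(L x) are cylindrical, so the Fourier transform of f ν vanishes. The finite
  -- measures f⁺ν and f⁻ν then share their characteristic function and coincide.
  have key : ∀ L : StrongDual ℝ X,
      ∫ x, Complex.exp (L x * Complex.I) * (f x : ℂ) ∂ν = 0 := by
    intro L
    have hcos : ∫ x, f x * Real.cos (L x) ∂ν = 0 := by
      refine hf _ (cylindrical_of_dual L Real.contDiff_cos ⟨1, Real.abs_cos_le_one⟩ ⟨1, fun r => ?_⟩)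
      rw [Real.deriv_cos, abs_neg]
      exact Real.abs_sin_le_one r
    have hsin : ∫ x, f x * Real.sin (L x) ∂ν = 0 := by
      refine hf _ (cylindrical_of_dual L Real.contDiff_sin ⟨1, Real.abs_sin_le_one⟩ ⟨1, fun r => ?_⟩)
      rw [Real.deriv_sin]
      exact Real.abs_cos_le_one r
    have icos : Integrable (fun x => f x * Real.cos (L x)) ν :=
      hint.mul_bdd (c := 1)
        (Real.continuous_cos.comp L.continuous).measurable.aestronglyMeasurable
        (Eventually.of_forall fun x => Real.abs_cos_le_one _)
    have isin : Integrable (fun x => f x * Real.sin (L x)) ν :=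
      hint.mul_bdd (c := 1)
        (Real.continuous_sin.comp L.continuous).measurable.aestronglyMeasurable
        (Eventually.of_forall fun x => Real.abs_sin_le_one _)
    have e : ∀ x, Complex.exp (L x * Complex.I) * (f x : ℂ) =
        ((f x * Real.cos (L x) : ℝ) : ℂ) + ((f x * Real.sin (L x) : ℝ) : ℂ) * Complex.I := by
      intro x
      rw [Complex.exp_mul_I]
      push_cast
      ring
    simp_rw [e]
    rw [integral_add icos.ofReal (isin.ofReal.mul_const _), integral_mul_const,
      integral_complex_ofReal, integral_complex_ofReal, hcos, hsin]
    simp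
  have hfin1 := isFiniteMeasure_withDensity_ofReal hint.2
  have hfin2 := isFiniteMeasure_withDensity_ofReal hneg.2
  have hchar : ∀ (g : X → ℝ), Integrable g ν → ∀ L : StrongDual ℝ X,
      charFunDual (ν.withDensity fun x => ENNReal.ofReal (g x)) L =
        ∫ x, Complex.exp (L x * Complex.I) * ((max (g x) 0 : ℝ) : ℂ) ∂ν := by
    intro g hg L
    rw [charFunDual_apply, integral_withDensity_eq_integral_toReal_smul₀
      hg.aemeasurable.ennreal_ofReal (Eventually.of_forall fun x => ENNReal.ofReal_lt_top)]
    refine integral_congr_ae (Eventually.of_forall fun x => ?_)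
    simp only [ENNReal.toReal_ofReal', Complex.real_smul]
    rw [mul_comm]
  have hbdd : ∀ (g : X → ℝ), Integrable g ν → ∀ L : StrongDual ℝ X,
      Integrable (fun x => Complex.exp (L x * Complex.I) * ((max (g x) 0 : ℝ) : ℂ)) ν := by
    intro g hg L
    refine hg.pos_part.ofReal.bdd_mul (c := 1) ?_
      (Eventually.of_forall fun x => (Complex.norm_exp_ofReal_mul_I _).le)
    have h : Continuous fun x => Complex.exp (L x * Complex.I) := by fun_prop
    exact h.measurable.aestronglyMeasurable
  have heq : (ν.withDensity fun x => ENNReal.ofReal (f x)) =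
      ν.withDensity fun x => ENNReal.ofReal (-f x) := by
    refine Measure.ext_of_charFunDual (funext fun L => ?_)
    rw [hchar _ hint, hchar _ hneg, ← sub_eq_zero,
      ← integral_sub (hbdd _ hint L) (hbdd _ hneg L), ← key L]
    refine integral_congr_ae (Eventually.of_forall fun x => ?_)
    dsimp only
    rw [← mul_sub, ← Complex.ofReal_sub]
    congr 2
    rcases le_total 0 (f x) with h | h
    · rw [max_eq_left h, max_eq_right (by linarith), sub_zero]
    · rw [max_eq_right h, max_eq_left (by linarith)]; ring
  rw [withDensity_eq_iff hint.aemeasurable.ennreal_ofReal hneg.aemeasurable.ennreal_ofReal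
    hint.lintegral_lt_top.ne] at heq
  refine Lp.ext ?_
  filter_upwards [heq, Lp.coeFn_zero ℝ 2 ν] with x hx h0
  rw [h0, Pi.zero_apply]
  rcases le_total 0 (f x) with h | h
  · rw [ENNReal.ofReal_of_nonpos (show -f x ≤ 0 by linarith), ENNReal.ofReal_eq_zero] at hx
    exact le_antisymm hx h
  · rw [ENNReal.ofReal_of_nonpos h, eq_comm, ENNReal.ofReal_eq_zero] at hx
    linarith

end Cylindrical

end WeightedOU

namespace WeightedOU

/-! ### The weighted Ornstein-Uhlenbeck semigroup -/

section Majorizing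

variable {α : Type*} [MeasurableSpace α] {ν : Measure α} [IsFiniteMeasure ν]

theorem real_inner_eq_mul (a b : ℝ) : inner ℝ a b = a * b := by
  simp [mul_comm]

/-- The functional is 1-Lipschitz for the L¹ norm, and L² embeds continuously in L¹. -/
theorem continuous_integral_posPart_sub (s : ℝ) :
    Continuous fun f : Lp ℝ 2 ν => ∫ x, max (f x - s) 0 ∂ν := by
  have h1 : LipschitzWith 1 fun f : Lp ℝ 1 ν => ∫ x, max (f x - s) 0 ∂ν := by
    refine LipschitzWith.of_dist_le_mul fun f g => ?_
    have hf := integrable_posPart_sub (integrable_coeFn f) s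
    have hg := integrable_posPart_sub (integrable_coeFn g) s
    rw [NNReal.coe_one, one_mul, dist_eq_norm, dist_eq_norm, L1.norm_eq_integral_norm,
      ← integral_sub hf hg]
    refine (norm_integral_le_integral_norm _).trans (integral_mono_ae (hf.sub hg).norm
      (integrable_coeFn (f - g)).norm ?_)
    filter_upwards [Lp.coeFn_sub f g] with x hx
    rw [hx, Pi.sub_apply, Real.norm_eq_abs, Real.norm_eq_abs]
    refine (abs_max_sub_max_le_max _ _ _ _).trans ?_
    rw [sub_self, abs_zero, max_eq_left (abs_nonneg _), sub_sub_sub_cancel_right]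
  have h2 := h1.continuous.comp (lpIncl ν (p := 1) (q := 2) (by norm_num)).continuous
  refine h2.congr fun f => integral_congr_ae ?_
  filter_upwards [coeFn_lpIncl (p := 1) (by norm_num) f] with x hx
  rw [hx]

theorem convex_setOf_integral_posPart_sub_le (s c : ℝ) :
    Convex ℝ {f : Lp ℝ 2 ν | ∫ x, max (f x - s) 0 ∂ν ≤ c} := by
  intro f hf g hg a b ha hb hab
  rw [Set.mem_ofPred_eq] at hf hg ⊢
  have if' := integrable_posPart_sub (integrable_coeFn f) s
  have ig := integrable_posPart_sub (integrable_coeFn g) s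
  have h1 : ∫ x, max ((a • f + b • g : Lp ℝ 2 ν) x - s) 0 ∂ν ≤
      ∫ x, (a * max (f x - s) 0 + b * max (g x - s) 0) ∂ν := by
    refine integral_mono_ae (integrable_posPart_sub (integrable_coeFn _) s)
      ((if'.const_mul a).add (ig.const_mul b)) ?_
    filter_upwards [Lp.coeFn_add (a • f) (b • g), Lp.coeFn_smul a f, Lp.coeFn_smul b g]
      with x h1 h2 h3
    rw [h1, Pi.add_apply, h2, h3, Pi.smul_apply, Pi.smul_apply, smul_eq_mul, smul_eq_mul]
    have e : a * f x + b * g x - s = a * (f x - s) + b * (g x - s) := by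
      linear_combination s * hab
    refine max_le ?_ (add_nonneg (mul_nonneg ha (le_max_right _ _))
      (mul_nonneg hb (le_max_right _ _)))
    rw [e]
    exact add_le_add (mul_le_mul_of_nonneg_left (le_max_left _ _) ha)
      (mul_le_mul_of_nonneg_left (le_max_left _ _) hb)
  rw [integral_add (if'.const_mul a) (ig.const_mul b), integral_const_mul,
    integral_const_mul] at h1
  calc _ ≤ _ := h1
    _ ≤ a * c + b * c := add_le_add (mul_le_mul_of_nonneg_left hf ha)
        (mul_le_mul_of_nonneg_left hg hb)
    _ = c := by rw [← add_mul, hab, one_mul]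

variable {H : Type*} [NormedAddCommGroup H] [InnerProductSpace ℝ H]

omit [IsFiniteMeasure ν] in
theorem neg_inner_compLpL {B : H →L[ℝ] H} (hB : ∀ h, -inner ℝ (B h) h = 1 / 2 * ‖h‖ ^ 2)
    (G : Lp H 2 ν) : -inner ℝ (B.compLpL 2 ν G) G = 1 / 2 * ‖G‖ ^ 2 := by
  rw [← real_inner_self_eq_norm_sq, L2.inner_def, L2.inner_def, ← integral_neg,
    ← integral_const_mul]
  refine integral_congr_ae ?_
  filter_upwards [B.coeFn_compLpL (p := 2) (μ := ν) G] with x hx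
  rw [hx, hB, real_inner_self_eq_norm_sq]

/-- The graph `Γ` is invariant under the composition with bounded functions of class `C^1` with a
bounded derivative, and the chain rule holds. -/
def HasChainRule (Γ : Set (Lp ℝ 2 ν × Lp H 2 ν)) : Prop :=
  ∀ w ∈ Γ, ∀ ψ : ℝ → ℝ, ContDiff ℝ 1 ψ → (∃ C, ∀ r, |ψ r| ≤ C) → (∃ C, ∀ r, |deriv ψ r| ≤ C) →
    ∃ w' ∈ Γ, w'.1 =ᵐ[ν] (fun x => ψ (w.1 x)) ∧ w'.2 =ᵐ[ν] fun x => deriv ψ (w.1 x) • w.2 x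

omit [IsFiniteMeasure ν] in
-- The test function ψ(u) is replaced by ψ(w.1) for a cylindrical approximation w of (u, G), with
-- explicit errors. The estimate needs no convergence of ψ'(w.1) to ψ'(u).
theorem HasChainRule.inner_le {Γ : Set (Lp ℝ 2 ν × Lp H 2 ν)} (hΓ : HasChainRule Γ)
    {B : H →L[ℝ] H} (hB : ∀ h, -inner ℝ (B h) h = 1 / 2 * ‖h‖ ^ 2) {l : ℝ} (hl : 0 < l)
    {f u a : Lp ℝ 2 ν} {G : Lp H 2 ν}
    (hG : ∀ w ∈ Γ, l * inner ℝ u w.1 - inner ℝ (B.compLpL 2 ν G) w.2 = l * inner ℝ f w.1)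
    {ψ : ℝ → ℝ} (hψ : ContDiff ℝ 1 ψ) (hmono : Monotone ψ) (hb : ∃ C, ∀ r, |ψ r| ≤ C) {D : ℝ}
    (hD : ∀ r, |deriv ψ r| ≤ D) (ha : a =ᵐ[ν] fun x => ψ (u x))
    {w : Lp ℝ 2 ν × Lp H 2 ν} (hw : w ∈ Γ) :
    l * inner ℝ (u - f) a ≤
      l * (‖u - f‖ * (D * ‖w.1 - u‖)) + ‖B.compLpL 2 ν G‖ * (D * ‖w.2 - G‖) := by
  have hlip : ∀ r s, |ψ r - ψ s| ≤ D * |r - s| := fun r s =>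
    Convex.norm_image_sub_le_of_norm_deriv_le (s := Set.univ) (f := ψ)
      (fun x _ => (hψ.differentiable one_ne_zero) x) (fun x _ => hD x) convex_univ
      (Set.mem_univ s) (Set.mem_univ r)
  obtain ⟨w', hw', h3, h4⟩ := hΓ w hw ψ hψ hb ⟨D, hD⟩
  have hmemR : MemLp (fun x => deriv ψ (w.1 x) • (w.2 - G) x) 2 ν := by
    refine MemLp.of_le_mul (c := D) (Lp.memLp (w.2 - G))
      (((hψ.continuous_deriv le_rfl).comp_aestronglyMeasurable
        (Lp.aestronglyMeasurable w.1)).smul (Lp.aestronglyMeasurable _))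
      (Eventually.of_forall fun x => ?_)
    rw [norm_smul]
    exact mul_le_mul_of_nonneg_right (hD _) (norm_nonneg _)
  let R : Lp H 2 ν := hmemR.toLp _
  have hR : R =ᵐ[ν] fun x => deriv ψ (w.1 x) • (w.2 - G) x := MemLp.coeFn_toLp hmemR
  have hRn : ‖R‖ ≤ D * ‖w.2 - G‖ := by
    refine Lp.norm_le_mul_norm_of_ae_le_mul ?_
    filter_upwards [hR] with x hx
    rw [hx, norm_smul]
    exact mul_le_mul_of_nonneg_right (hD _) (norm_nonneg _)
  have han : ‖w'.1 - a‖ ≤ D * ‖w.1 - u‖ := by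
    refine Lp.norm_le_mul_norm_of_ae_le_mul ?_
    filter_upwards [Lp.coeFn_sub w'.1 a, Lp.coeFn_sub w.1 u, h3, ha] with x e1 e2 e4 e5
    rw [e1, e2, Pi.sub_apply, Pi.sub_apply, e4, e5]
    exact hlip _ _
  -- Subtracting `R` replaces the gradient of w by G while keeping the factor ψ'(w.1) ≥ 0, so the
  -- integrand is ψ'(w.1) [B G, G] ≤ 0 pointwise.
  have hV : inner ℝ (B.compLpL 2 ν G) (w'.2 - R) ≤ (0 : ℝ) := by
    rw [L2.inner_def]
    refine integral_nonpos_of_ae ?_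
    filter_upwards [B.coeFn_compLpL (p := 2) (μ := ν) G, Lp.coeFn_sub w'.2 R,
      Lp.coeFn_sub w.2 G, h4, hR] with x e1 e2 e3 e5 e6
    rw [e1, e2, Pi.sub_apply, e5, e6, e3, Pi.sub_apply, ← smul_sub, sub_sub_cancel,
      real_inner_smul_right]
    refine mul_nonpos_of_nonneg_of_nonpos hmono.deriv_nonneg ?_
    have := hB (G x)
    nlinarith [sq_nonneg ‖G x‖]
  have e1 := hG w' hw'
  have e2 : l * inner ℝ (u - f) w'.1 = inner ℝ (B.compLpL 2 ν G) w'.2 := by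
    rw [inner_sub_left]; linarith
  have e3 : (inner ℝ (B.compLpL 2 ν G) w'.2 : ℝ) =
      inner ℝ (B.compLpL 2 ν G) (w'.2 - R) + inner ℝ (B.compLpL 2 ν G) R := by
    rw [← inner_add_right, sub_add_cancel]
  have e4 : (inner ℝ (B.compLpL 2 ν G) R : ℝ) ≤ ‖B.compLpL 2 ν G‖ * (D * ‖w.2 - G‖) :=
    (real_inner_le_norm _ _).trans (mul_le_mul_of_nonneg_left hRn (norm_nonneg _))
  have e5 : (inner ℝ (u - f) a : ℝ) = inner ℝ (u - f) w'.1 - inner ℝ (u - f) (w'.1 - a) := by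
    rw [← inner_sub_right, sub_sub_cancel]
  have e6 : -(inner ℝ (u - f) (w'.1 - a) : ℝ) ≤ ‖u - f‖ * (D * ‖w.1 - u‖) :=
    (neg_le_abs _).trans ((abs_real_inner_le_norm _ _).trans
      (mul_le_mul_of_nonneg_left han (norm_nonneg _)))
  have e7 := mul_le_mul_of_nonneg_left e6 hl.le
  rw [e5, mul_sub, e2]
  linarith

/-- The bound is a closed condition on w, and at the limit point (u, G) the error terms vanish. -/
theorem nonpos_of_mem_closure {E F : Type*} [NormedAddCommGroup E] [NormedAddCommGroup F]
    {Γ : Set (E × F)} {u : E} {G : F} (h : (u, G) ∈ closure Γ) {c l k m D : ℝ}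
    (hΓ : ∀ w ∈ Γ, c ≤ l * (k * (D * ‖w.1 - u‖)) + m * (D * ‖w.2 - G‖)) : c ≤ 0 := by
  have hcl : IsClosed {w : E × F | c ≤ l * (k * (D * ‖w.1 - u‖)) + m * (D * ‖w.2 - G‖)} :=
    isClosed_le (by fun_prop) (by fun_prop)
  have h1 : c ≤ l * (k * (D * ‖u - u‖)) + m * (D * ‖G - G‖) := closure_minimal hΓ hcl h
  simpa using h1

theorem HasChainRule.isMajorizing {Γ : Set (Lp ℝ 2 ν × Lp H 2 ν)} (hΓ : HasChainRule Γ)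
    {B : H →L[ℝ] H} (hB : ∀ h, -inner ℝ (B h) h = 1 / 2 * ‖h‖ ^ 2) {l : ℝ} (hl : 0 < l)
    {J : Lp ℝ 2 ν →L[ℝ] Lp ℝ 2 ν}
    (hJ : ∀ f, ∃ G : Lp H 2 ν, (J f, G) ∈ closure Γ ∧
      ∀ w ∈ closure Γ,
        l * inner ℝ (J f) w.1 - inner ℝ (B.compLpL 2 ν G) w.2 = l * inner ℝ f w.1) :
    IsMajorizing J := by
  intro f
  obtain ⟨G, hG, hw⟩ := hJ f
  refine majorized_of_test (integrable_coeFn f) (integrable_coeFn (J f))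
    fun ψ hψ hmono hb hd => ?_
  obtain ⟨D, hD⟩ := hd
  obtain ⟨a, ha⟩ : ∃ a : Lp ℝ 2 ν, a =ᵐ[ν] fun x => ψ (J f x) := by
    obtain ⟨C, hC⟩ := hb
    have hmem : MemLp (fun x => ψ (J f x)) 2 ν :=
      MemLp.of_bound (hψ.continuous.comp_aestronglyMeasurable (Lp.aestronglyMeasurable (J f))) C
        (Eventually.of_forall fun x => hC _)
    exact ⟨hmem.toLp _, MemLp.coeFn_toLp hmem⟩
  have hlim : l * inner ℝ (J f - f) a ≤ 0 :=
    nonpos_of_mem_closure hG fun w hw' =>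
      hΓ.inner_le hB hl (fun w hw' => hw w (subset_closure hw')) hψ hmono hb hD ha hw'
  have hle : (inner ℝ (J f - f) a : ℝ) ≤ 0 := nonpos_of_mul_nonpos_right hlim hl
  rw [L2.inner_def] at hle
  refine (integral_congr_ae ?_).trans_le hle
  filter_upwards [Lp.coeFn_sub (J f) f, ha] with x e1 e2
  rw [e1, e2, real_inner_eq_mul, Pi.sub_apply]

end Majorizing

/-! ### The form of L_2 on cylindrical functions and its semigroup -/

section Semigroup

variable {X : Type*} [NormedAddCommGroup X] [NormedSpace ℝ X]
  [TopologicalSpace.SeparableSpace X] [MeasurableSpace X] [BorelSpace X]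
  (Q : PosSymOp X) (ν : Measure X) [IsFiniteMeasure ν]

/-- The graph of `D_H` on the cylindrical functions. -/
noncomputable def cylGraph : Submodule ℝ (Lp ℝ 2 ν × Lp (RKHS Q) 2 ν) where
  carrier := {z | ∃ f ∈ cylindrical X, z.1 =ᵐ[ν] f ∧ z.2 =ᵐ[ν] gradCyl Q f}
  add_mem' := by
    rintro a b ⟨f, hf, h1, h2⟩ ⟨g, hg, h3, h4⟩
    refine ⟨_, add_mem_cylindrical hf hg, ?_, ?_⟩
    · exact (Lp.coeFn_add a.1 b.1).trans (h1.add h3)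
    · refine (Lp.coeFn_add a.2 b.2).trans ((h2.add h4).trans
        (Eventually.of_forall fun x => ?_))
      exact (gradCyl_add Q hf hg x).symm
  zero_mem' := by
    refine ⟨_, zero_mem_cylindrical, Lp.coeFn_zero ℝ 2 ν, ?_⟩
    refine (Lp.coeFn_zero (RKHS Q) 2 ν).trans (Eventually.of_forall fun x => ?_)
    have := gradCyl_smul Q (zero_mem_cylindrical (X := X)) 0 x
    simp only [zero_mul, zero_smul] at this
    exact this.symm
  smul_mem' := by
    rintro c a ⟨f, hf, h1, h2⟩
    refine ⟨_, smul_mem_cylindrical hf c, ?_, ?_⟩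
    · filter_upwards [Lp.coeFn_smul c a.1, h1] with x h3 h4
      change (c • a.1 : Lp ℝ 2 ν) x = _
      rw [h3, Pi.smul_apply, h4, smul_eq_mul]
    · filter_upwards [Lp.coeFn_smul c a.2, h2] with x h3 h4
      change (c • a.2 : Lp (RKHS Q) 2 ν) x = _
      rw [h3, Pi.smul_apply, h4, gradCyl_smul Q hf]

variable {Q ν}

theorem exists_mem_cylGraph {f : X → ℝ} (hf : f ∈ cylindrical X) :
    ∃ w ∈ cylGraph Q ν, w.1 =ᵐ[ν] f ∧ w.2 =ᵐ[ν] gradCyl Q f := by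
  have h1 := MemLp.coeFn_toLp (memLp_cylindrical (ν := ν) hf 2)
  have h2 := MemLp.coeFn_toLp (memLp_gradCyl (ν := ν) Q hf 2)
  exact ⟨⟨_, _⟩, ⟨f, hf, h1, h2⟩, h1, h2⟩

/-- Both sides of the weak equation are continuous in the pair (v, D_H v), so testing with
cylindrical functions is the same as testing with the whole closure. -/
theorem ouGraph_eq_formGraph (B : RKHS Q →L[ℝ] RKHS Q) :
    ouGraph Q B ν = formGraph (cylGraph Q ν).topologicalClosure (B.compLpL 2 ν) := by
  have key : ∀ (g : Lp ℝ 2 ν) (F : Lp (RKHS Q) 2 ν),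
      (∀ v ∈ cylindrical X,
        -∫ x, inner ℝ (B (F x)) (gradCyl Q v x) ∂ν = -∫ x, g x * v x ∂ν) ↔
      ∀ w ∈ (cylGraph Q ν).topologicalClosure,
        inner ℝ (B.compLpL 2 ν F) w.2 = (inner ℝ g w.1 : ℝ) := by
    intro g F
    have hinner : ∀ (w : Lp ℝ 2 ν × Lp (RKHS Q) 2 ν) (v : X → ℝ), w.1 =ᵐ[ν] v →
        w.2 =ᵐ[ν] gradCyl Q v →
        (inner ℝ (B.compLpL 2 ν F) w.2 = ∫ x, inner ℝ (B (F x)) (gradCyl Q v x) ∂ν ∧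
          (inner ℝ g w.1 : ℝ) = ∫ x, g x * v x ∂ν) := by
      intro w v h1 h2
      rw [L2.inner_def, L2.inner_def]
      constructor
      · refine integral_congr_ae ?_
        filter_upwards [B.coeFn_compLpL (p := 2) (μ := ν) F, h2] with x h3 h4
        rw [h3, h4]
      · refine integral_congr_ae ?_
        filter_upwards [h1] with x h3
        rw [h3, real_inner_eq_mul]
    constructor
    · intro h w hw
      refine closure_minimal (t := {w | inner ℝ (B.compLpL 2 ν F) w.2 = (inner ℝ g w.1 : ℝ)})
        ?_ (isClosed_eq (by fun_prop) (by fun_prop)) hw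
      rintro w ⟨v, hv, h1, h2⟩
      obtain ⟨e1, e2⟩ := hinner w v h1 h2
      rw [Set.mem_ofPred_eq, e1, e2]
      exact neg_injective (h v hv)
    · intro h v hv
      obtain ⟨w, hw, h1, h2⟩ := exists_mem_cylGraph (Q := Q) (ν := ν) hv
      obtain ⟨e1, e2⟩ := hinner w v h1 h2
      rw [← e1, ← e2, h w (subset_closure hw)]
  ext z
  exact exists_congr fun F => and_congr_right fun _ => key z.2 F

theorem hasChainRule_cylGraph :
    HasChainRule (cylGraph Q ν : Set (Lp ℝ 2 ν × Lp (RKHS Q) 2 ν)) := by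
  rintro w ⟨v, hv, h1, h2⟩ ψ hψ hb hd
  obtain ⟨w', hw', h3, h4⟩ := exists_mem_cylGraph (Q := Q) (ν := ν)
    (comp_mem_cylindrical hv hψ hb hd)
  refine ⟨w', hw', ?_, ?_⟩
  · filter_upwards [h1, h3] with x e1 e2
    rw [e2, e1]
  · filter_upwards [h1, h2, h4] with x e1 e2 e3
    rw [e3, e1, e2, gradCyl_comp Q hv hψ]

theorem exists_ouSemigroup [CompleteSpace X] (B : RKHS Q →L[ℝ] RKHS Q)
    (hB : ∀ h, -inner ℝ (B h) h = 1 / 2 * ‖h‖ ^ 2) :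
    ∃ T : C0Semigroup (Lp ℝ 2 ν), T.IsContraction ∧ T.generator = ouGraph Q B ν ∧
      ∀ t, IsMajorizing (T.toFun t) := by
  obtain ⟨J, hJ, hJ'⟩ := exists_isResolvent_formGraph
    (Γ := (cylGraph Q ν).topologicalClosure) (b := B.compLpL 2 ν)
    (cylGraph Q ν).isClosed_topologicalClosure (neg_inner_compLpL hB) fun f hf => by
      refine eq_zero_of_forall_cylindrical f fun v hv => ?_
      obtain ⟨w, hw, h1, -⟩ := exists_mem_cylGraph (Q := Q) (ν := ν) hv
      rw [← hf w (subset_closure hw), L2.inner_def]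
      refine integral_congr_ae ?_
      filter_upwards [h1] with x hx
      rw [hx, real_inner_eq_mul]
  obtain ⟨T, hT, hgen, hK⟩ := hJ.exists_semigroup
  refine ⟨T, hT, hgen.trans (ouGraph_eq_formGraph B).symm, fun t f s => ?_⟩
  -- For fixed f and s this set is closed, convex, invariant under every resolvent and contains f;
  -- hence it contains T(t) f.
  exact hK {g | ∫ x, max (g x - s) 0 ∂ν ≤ ∫ x, max (f x - s) 0 ∂ν}
    (isClosed_le (continuous_integral_posPart_sub s) continuous_const)
    (convex_setOf_integral_posPart_sub_le s _)
    (fun l hl g hg => (hasChainRule_cylGraph.isMajorizing hB hl (hJ' l hl) g s).trans hg) t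
    (le_refl (∫ x, max (f x - s) 0 ∂ν))

end Semigroup

end WeightedOU

/-! ### The main theorem -/

theorem mainTheorem6 {X : Type*} [NormedAddCommGroup X] [NormedSpace ℝ X] [CompleteSpace X]
    [TopologicalSpace.SeparableSpace X] [MeasurableSpace X] [BorelSpace X]
    (Q : WeightedOU.PosSymOp X)
    (S : WeightedOU.C0Semigroup X) (hS : S.IsContraction)
    (hQt : ∀ t : ℝ, 0 < t → ∃ γ : Measure X,
      WeightedOU.IsCentredGaussian γ (WeightedOU.covAt Q S t))
    (Qinf : StrongDual ℝ X → X)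
    (hQinf : ∀ x' y' : StrongDual ℝ X,
      Tendsto (fun t : ℝ => y' (WeightedOU.covAt Q S t x')) atTop (𝓝 (y' (Qinf x'))))
    (μ : Measure X) (hμ : WeightedOU.IsCentredGaussian μ Qinf)
    (hnondeg : ∀ x' : StrongDual ℝ X, x' ≠ 0 → 0 < x' (Qinf x'))
    (hRKH : ∃ c : ℝ, 0 < c ∧ ∀ z ∈ S.adjointGenerator, ∃ h : WeightedOU.RKHS Q,
      WeightedOU.RKHS.embed Q h = Qinf z.2 ∧ ‖h‖ ≤ c * ‖WeightedOU.RKHS.iStar Q z.1‖)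
    (U : X → EReal) (hU : WeightedOU.IsAdmissibleWeight Q μ U) :
    ∃ (B : WeightedOU.RKHS Q →L[ℝ] WeightedOU.RKHS Q)
      (T₂ : WeightedOU.C0Semigroup (Lp ℝ 2 (WeightedOU.weighted μ U))),
      WeightedOU.IsDriftOperator Q S Qinf B ∧
      T₂.IsContraction ∧
      T₂.generator = WeightedOU.ouGraph Q B (WeightedOU.weighted μ U) ∧
      (∀ (p : ℝ≥0∞) [Fact (1 ≤ p)], 1 < p → p < ∞ →
        ∃! T : WeightedOU.C0Semigroup (Lp ℝ p (WeightedOU.weighted μ U)),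
          WeightedOU.IsLpExtension T₂ p T) ∧
      (∀ (p q : ℝ≥0∞) [Fact (1 ≤ p)] [Fact (1 ≤ q)], 1 < p → p < q → q < ∞ →
        ∀ (Tp : WeightedOU.C0Semigroup (Lp ℝ p (WeightedOU.weighted μ U)))
          (Tq : WeightedOU.C0Semigroup (Lp ℝ q (WeightedOU.weighted μ U))),
          WeightedOU.IsLpExtension T₂ p Tp → WeightedOU.IsLpExtension T₂ q Tq →
          ∃ C : ℝ, ∀ z ∈ Tq.generator, ∃ w ∈ Tp.generator,
            w.1 =ᵐ[WeightedOU.weighted μ U] z.1 ∧ w.2 =ᵐ[WeightedOU.weighted μ U] z.2 ∧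
            ‖w.1‖ + ‖w.2‖ ≤ C * (‖z.1‖ + ‖z.2‖)) ∧
      (∀ (p : ℝ≥0∞) [Fact (1 ≤ p)], 2 ≤ p → p < ∞ →
        ∀ Tp : WeightedOU.C0Semigroup (Lp ℝ p (WeightedOU.weighted μ U)),
          WeightedOU.IsLpExtension T₂ p Tp →
          ∃ C : ℝ, ∀ z ∈ Tp.generator,
            ∃ w ∈ WeightedOU.sobolevGraph Q (WeightedOU.weighted μ U) 2,
              w.1 =ᵐ[WeightedOU.weighted μ U] z.1 ∧
              ‖w.1‖ + ‖w.2‖ ≤ C * (‖z.1‖ + ‖z.2‖)) := by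
  have hμ' : IsGaussian μ := hμ.1
  have hfin : IsFiniteMeasure (WeightedOU.weighted μ U) := by
    obtain ⟨x', c, h⟩ :=
      WeightedOU.exists_affine_le hU.ne_bot hU.exists_ne_top hU.lsc hU.convex
    exact WeightedOU.isFiniteMeasure_weighted h
  obtain ⟨B, hB, hB'⟩ := WeightedOU.exists_driftOperator Q S hS Qinf hQinf μ hμ hRKH
  obtain ⟨T₂, hT₂, hgen, hmaj⟩ :=
    WeightedOU.exists_ouSemigroup (ν := WeightedOU.weighted μ U) B hB'
  refine ⟨B, T₂, hB, hT₂, hgen, fun p _ h1 h2 => ?_, fun p q _ _ h1 h2 h3 Tp Tq hTp hTq => ?_,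
    fun p _ h1 h2 Tp hTp => ?_⟩
  · obtain ⟨T, hT⟩ := WeightedOU.exists_isLpExtension hmaj h1 h2
    exact ⟨T, hT, fun T' hT' => hT'.unique h2.ne hT⟩
  · refine ⟨‖WeightedOU.lpIncl (WeightedOU.weighted μ U) h2.le‖, fun z hz =>
      ⟨(WeightedOU.lpIncl _ h2.le z.1, WeightedOU.lpIncl _ h2.le z.2),
        WeightedOU.C0Semigroup.map_mem_generator _
          (fun t f => hTp.lpIncl_apply h2.le h3.ne hTq t f) hz,
        WeightedOU.coeFn_lpIncl _ _, WeightedOU.coeFn_lpIncl _ _, ?_⟩⟩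
    rw [mul_add]
    exact add_le_add (ContinuousLinearMap.le_opNorm _ _) (ContinuousLinearMap.le_opNorm _ _)
  -- For p ≥ 2 the inclusion maps D(L_p) into D(L_2). The energy bound ‖G‖ ≤ ‖j u‖ + ‖j L_p u‖
  -- counts ‖j u‖ a second time, whence the constant 2‖j‖.
  · let j := WeightedOU.lpIncl (WeightedOU.weighted μ U) h1
    have hj : ∀ t f, j (Tp.toFun t f) = T₂.toFun t (j f) := fun t f =>
      Lp.ext ((WeightedOU.coeFn_lpIncl h1 _).trans
        (hTp.consistent t (j f) f (WeightedOU.coeFn_lpIncl h1 f)).symm)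
    refine ⟨2 * ‖j‖, fun z hz => ?_⟩
    have hz' := WeightedOU.C0Semigroup.map_mem_generator j hj hz
    rw [hgen, WeightedOU.ouGraph_eq_formGraph] at hz'
    obtain ⟨G, hG, hGn⟩ :=
      WeightedOU.norm_sq_le_of_mem_formGraph (WeightedOU.neg_inner_compLpL hB') hz'
    refine ⟨(j z.1, G), hG, WeightedOU.coeFn_lpIncl h1 _, ?_⟩
    have e1 := j.le_opNorm z.1
    have e2 := j.le_opNorm z.2
    have e3 := mul_nonneg (norm_nonneg j) (norm_nonneg z.2)
    change ‖j z.1‖ + ‖G‖ ≤ 2 * ‖j‖ * (‖z.1‖ + ‖z.2‖)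
    linarith
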